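/- Let $\mathcal D_4\cong\mathbb P^{14}$ be the space of complex plane quartics; for $[a]\in\mathcal D_4$ let $s_a$ be the corresponding quartic form, regarded as a section of $\mathcal O_{\mathbb P^2}(4)$. For points $p_1,\dots,p_{11}\in\mathbb P^2$ let $\mathcal D\subset\mathcal D_4$ be the linear subspace of quartics passing through $p_1,\dots,p_{11}$, and set $$\mathcal N_1''=\{([a],x)\in\mathcal D\times\mathbb P^2 : s_a(x)=0,\ ds_a|_x=0\}.$$ Let $\mathcal T_1\subset\mathcal N_1''$ be the set of pairs $([a],x)$ with a tacnode in the following sense: there is a line $L\subset T_x\mathbb P^2$ that is contained in the kernel of the Hessian of $s_a$ at $x$ and along which the third derivative of $s_a$ at $x$ vanishes. Let $$\tilde{\mathcal N}_{2;0}'=\{([a],x_1,x_2)\in\mathcal N_1''\times\mathbb P^2 : x_1\neq x_2,\ s_a(x_2)=0,\ ds_a|_{x_2}=0\},$$ and let $\tilde{\mathcal N}_2'$ be its closure in $\mathcal N_1''\times\mathbb P^2$ (in the classical topology). If $p_1,\dots,p_{11}$ are in general position (that is, for all $(p_1,\dots,p_{11})$ in the complement of the zero set of some nonzero multihomogeneous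 polynomial on $(\mathbb P^2)^{11}$), then $\mathcal D\cong\mathbb P^3$ and $$\tilde{\mathcal N}_2'-\tilde{\mathcal N}_{2;0}'=\{([a],x,x)\in\mathcal N_1''\times\mathbb P^2 : ([a],x)\in\mathcal T_1\}.$$ -/

import Mathlib

open scoped LinearAlgebra.Projectivization

noncomputable section

namespace PlaneQuartic

open MvPolynomial

/-- The quotient topology on a projective space `(V - 0) / K^*`. -/
instance projectivizationTopology {K V : Type*} [DivisionRing K] [AddCommGroup V] [Module K V]
    [TopologicalSpace V] : TopologicalSpace (ℙ K V) :=
  TopologicalSpace.coinduced (Projectivization.mk' K : {v : V // v ≠ 0} → ℙ K V) inferInstance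

/-- The complex projective plane. -/
abbrev P2 : Type := ℙ ℂ (Fin 3 → ℂ)

/-- Coefficient vectors `(a_{jkl})_{j+k+l=4}`, a copy of `ℂ^15`. -/
abbrev QuarticCoeff : Type :=
  {m : Fin 3 → ℕ // m ∈ Finset.piAntidiag (Finset.univ : Finset (Fin 3)) 4} → ℂ

/-- The space `𝒟₄` of plane quartics, a copy of `ℙ^14`. -/
abbrev QuarticSpace : Type := ℙ ℂ QuarticCoeff

/-- The quartic form `s_a = ∑ a_{jkl} X^j Y^k Z^l`, depending linearly on `a`. -/
def form : QuarticCoeff →ₗ[ℂ] MvPolynomial (Fin 3) ℂ :=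
  Fintype.linearCombination ℂ
    (fun m : {m : Fin 3 → ℕ // m ∈ Finset.piAntidiag (Finset.univ : Finset (Fin 3)) 4} =>
      ∏ i, (X i : MvPolynomial (Fin 3) ℂ) ^ m.1 i)

/-- The first partial derivatives at `x` of the form of `a`. -/
def grad (a : QuarticCoeff) (x : Fin 3 → ℂ) (i : Fin 3) : ℂ :=
  eval x (pderiv i (form a))

/-- The second partial derivatives at `x` of the form of `a`. -/
def hess (a : QuarticCoeff) (x : Fin 3 → ℂ) (i j : Fin 3) : ℂ :=
  eval x (pderiv i (pderiv j (form a)))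

/-- The third partial derivatives at `x` of the form of `a`. -/
def third (a : QuarticCoeff) (x : Fin 3 → ℂ) (i j k : Fin 3) : ℂ :=
  eval x (pderiv i (pderiv j (pderiv k (form a))))

/-- `s_a(x) = 0` and `ds_a|_x = 0`, in homogeneous coordinates. If `s_a(x) = 0`, the differential
of the form at `x` kills the line of `x` and induces `ds_a|_x` on the tangent space
`T_x ℙ² ≅ ℂ³ / ℂ x`; so one vanishes if and only if the other does. -/
def SingularVec (a : QuarticCoeff) (x : Fin 3 → ℂ) : Prop :=
  eval x (form a) = 0 ∧ ∀ i, grad a x i = 0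

/-- The condition that the (nonzero) class of `v` in `T_x ℙ² ≅ ℂ³ / ℂ x` is in the kernel of the
Hessian `H_{a,x}`, and that the third derivative of `s_a` at `x` along it vanishes. -/
def TacnodalVec (a : QuarticCoeff) (x v : Fin 3 → ℂ) : Prop :=
  (∀ i, ∑ j, hess a x i j * v j = 0) ∧
    ∑ i, ∑ j, ∑ k, third a x i j k * v i * v j * v k = 0

/-- The quartic `a` is singular at `x`. -/
def IsSingularAt (a : QuarticSpace) (x : P2) : Prop :=
  SingularVec a.rep x.rep

/-- There is a tangent direction at `x` in the kernel of the Hessian of `s_a` at `x` along which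
the third derivative vanishes as well. -/
def HasTacnodalDirection (a : QuarticSpace) (x : P2) : Prop :=
  ∃ v : Fin 3 → ℂ, v ∉ x.submodule ∧ TacnodalVec a.rep x.rep v

/-- The linear space of (coefficient vectors of) quartic forms that vanish at all `p i`. -/
def formsThrough {n : ℕ} (p : Fin n → P2) : Submodule ℂ QuarticCoeff where
  carrier := {a | ∀ i, eval (p i).rep (form a) = 0}
  add_mem' ha hb i := by simp [ha i, hb i]
  zero_mem' i := by simp
  smul_mem' c a ha i := by simp [ha i]

/-- The family `𝒟` of plane quartics that pass through all `p i`. -/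
def quarticsThrough {n : ℕ} (p : Fin n → P2) : Set QuarticSpace :=
  {a | a.submodule ≤ formsThrough p}

/-- `𝒩₁''`: pairs of a quartic in `𝒟` and a point where it is singular. -/
def nodalPairs {n : ℕ} (p : Fin n → P2) : Set (quarticsThrough p × P2) :=
  {z | IsSingularAt z.1 z.2}

/-- `𝒯₁`, viewed as a subset of `𝒩₁''`. -/
def tacnodalPairs {n : ℕ} (p : Fin n → P2) : Set (nodalPairs p) :=
  {z | HasTacnodalDirection z.1.1 z.1.2}

/-- The locus in `𝒩₁'' × ℙ²` of quartics in `𝒟` with two distinct (ordered) singular points. -/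
def binodalLocus {n : ℕ} (p : Fin n → P2) : Set (nodalPairs p × P2) :=
  {z | z.1.1.2 ≠ z.2 ∧ IsSingularAt z.1.1.1 z.2}

/-- `P` holds for `n` points of the plane in general position: it holds for all `n`-tuples in the
complement of the zero set of some nonzero multihomogeneous polynomial on `(ℙ²)^n`, hence on a
nonempty Zariski-open subset. -/
def ForGeneralPoints (n : ℕ) (P : (Fin n → P2) → Prop) : Prop :=
  ∃ F : MvPolynomial (Fin n × Fin 3) ℂ, F ≠ 0 ∧
    (∃ d : Fin n → ℕ, ∀ i,
      IsWeightedHomogeneous (fun q : Fin n × Fin 3 => if q.1 = i then 1 else 0) F (d i)) ∧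
    ∀ p : Fin n → P2, eval (fun q : Fin n × Fin 3 => (p q.1).rep q.2) F ≠ 0 → P p

/-! The conditions above do not depend on the choice of homogeneous coordinates. -/

lemma form_isHomogeneous (a : QuarticCoeff) : (form a).IsHomogeneous 4 := by
  rw [form, Fintype.linearCombination_apply]
  refine IsHomogeneous.sum _ _ _ fun m _ => ?_
  have h : (∏ i, (X i : MvPolynomial (Fin 3) ℂ) ^ m.1 i).IsHomogeneous (∑ i, m.1 i) :=
    IsHomogeneous.prod _ _ _ fun i _ => by
      simpa using (isHomogeneous_X ℂ i).pow (m.1 i)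
  have hm : ∑ i, m.1 i = 4 := (Finset.mem_piAntidiag.1 m.2).1
  rw [hm] at h
  rw [smul_eq_C_mul]
  simpa using (isHomogeneous_C (Fin 3) (a m)).mul h

lemma eval_smul_of_isHomogeneous {f : MvPolynomial (Fin 3) ℂ} {d : ℕ} (hf : f.IsHomogeneous d)
    (c : ℂ) (x : Fin 3 → ℂ) : eval (c • x) f = c ^ d * eval x f := by
  rw [eval_eq, eval_eq, Finset.mul_sum]
  refine Finset.sum_congr rfl fun m hm => ?_
  have h : ∑ i ∈ m.support, m i = d := by
    have := hf (mem_support_iff.1 hm)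
    rwa [Finsupp.weight_apply, Finsupp.sum, Finset.sum_congr rfl
      (fun i _ => by simp : ∀ i ∈ m.support, m i • (1 : Fin 3 → ℕ) i = m i)] at this
  simp only [Pi.smul_apply, smul_eq_mul, mul_pow, Finset.prod_mul_distrib, Finset.prod_pow_eq_pow_sum, h]
  ring

lemma euler {f : MvPolynomial (Fin 3) ℂ} {d : ℕ} (hf : f.IsHomogeneous d) (x : Fin 3 → ℂ) :
    ∑ i, x i * eval x (pderiv i f) = d * eval x f := by
  simpa using congrArg (eval x) hf.sum_X_mul_pderiv

lemma grad_smul (a : QuarticCoeff) (x : Fin 3 → ℂ) (b c : ℂ) (i : Fin 3) :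
    grad (b • a) (c • x) i = b * c ^ 3 * grad a x i := by
  simp only [grad, map_smul, Derivation.map_smul, smul_eval]
  rw [eval_smul_of_isHomogeneous (form_isHomogeneous a).pderiv, mul_assoc]

lemma hess_smul (a : QuarticCoeff) (x : Fin 3 → ℂ) (b c : ℂ) (i j : Fin 3) :
    hess (b • a) (c • x) i j = b * c ^ 2 * hess a x i j := by
  simp only [hess, map_smul, Derivation.map_smul, smul_eval]
  rw [eval_smul_of_isHomogeneous (form_isHomogeneous a).pderiv.pderiv, mul_assoc]

lemma third_smul (a : QuarticCoeff) (x : Fin 3 → ℂ) (b c : ℂ) (i j k : Fin 3) :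
    third (b • a) (c • x) i j k = b * c * third a x i j k := by
  simp only [third, map_smul, Derivation.map_smul, smul_eval]
  rw [eval_smul_of_isHomogeneous (form_isHomogeneous a).pderiv.pderiv.pderiv]
  ring

lemma singularVec_smul {a : QuarticCoeff} {x : Fin 3 → ℂ} {b c : ℂ} (hb : b ≠ 0) (hc : c ≠ 0) :
    SingularVec (b • a) (c • x) ↔ SingularVec a x := by
  simp only [SingularVec, grad_smul, map_smul, smul_eval,
    eval_smul_of_isHomogeneous (form_isHomogeneous a)]
  simp [hb, hc]

lemma tacnodalVec_smul {a : QuarticCoeff} {x v : Fin 3 → ℂ} {b c : ℂ} (hb : b ≠ 0) (hc : c ≠ 0) :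
    TacnodalVec (b • a) (c • x) v ↔ TacnodalVec a x v := by
  simp only [TacnodalVec, hess_smul, third_smul]
  simp only [mul_assoc, ← Finset.mul_sum]
  simp [hb, hc]

lemma pderiv_pderiv_comm (i j : Fin 3) (f : MvPolynomial (Fin 3) ℂ) :
    pderiv i (pderiv j f) = pderiv j (pderiv i f) := by
  have h : ⁅(pderiv i : Derivation ℂ (MvPolynomial (Fin 3) ℂ) (MvPolynomial (Fin 3) ℂ)),
      (pderiv j : Derivation ℂ (MvPolynomial (Fin 3) ℂ) (MvPolynomial (Fin 3) ℂ))⁆ = 0 := by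
    refine MvPolynomial.derivation_ext fun k => ?_
    simp [Derivation.commutator_apply, pderiv_X, Pi.single_apply, apply_ite]
  have h' := DFunLike.congr_fun h f
  simpa [Derivation.commutator_apply, sub_eq_zero] using h'

lemma hess_symm (a : QuarticCoeff) (x : Fin 3 → ℂ) (i j : Fin 3) :
    hess a x i j = hess a x j i := by
  simp only [hess, pderiv_pderiv_comm]

lemma sum_mul_hess (a : QuarticCoeff) (x : Fin 3 → ℂ) (j : Fin 3) :
    ∑ i, x i * hess a x i j = 3 * grad a x j := by
  exact euler (form_isHomogeneous a).pderiv x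

lemma sum_mul_third (a : QuarticCoeff) (x : Fin 3 → ℂ) (j k : Fin 3) :
    ∑ i, x i * third a x i j k = 2 * hess a x j k := by
  exact euler (form_isHomogeneous a).pderiv.pderiv x

/-- The tacnodal condition on `v` depends only on the direction of `v` in `ℂ³ / ℂ x`. -/
lemma TacnodalVec.smul_add {a : QuarticCoeff} {x v : Fin 3 → ℂ} (h : SingularVec a x)
    (hv : TacnodalVec a x v) (c e : ℂ) : TacnodalVec a x (c • v + e • x) := by
  have hH : ∀ j, ∑ i, x i * hess a x i j = 0 := fun j => by simp [sum_mul_hess, h.2 j]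
  have hT := sum_mul_third a x
  have s1 : ∀ i j k, third a x i j k = third a x j i k := fun i j k => by
    simp only [third, pderiv_pderiv_comm i j]
  have s2 : ∀ i j k, third a x i j k = third a x i k j := fun i j k => by
    simp only [third, pderiv_pderiv_comm j k]
  refine ⟨fun i => ?_, ?_⟩
  · have h1 := hv.1 i
    have h2 := hH i
    simp only [hess_symm a x _ i] at h2
    simp only [Fin.sum_univ_three, Pi.add_apply, Pi.smul_apply, smul_eq_mul] at *
    linear_combination c * h1 + e * h2
  · have key : ∀ u w : Fin 3 → ℂ, ∑ i, ∑ j, ∑ k, third a x i j k * x i * u j * w k =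
        2 * ∑ j, u j * ∑ k, hess a x j k * w k := fun u w => by
      simp only [Fin.sum_univ_three] at *
      linear_combination (u 0 * w 0) * hT 0 0 + (u 0 * w 1) * hT 0 1 + (u 0 * w 2) * hT 0 2 +
        (u 1 * w 0) * hT 1 0 + (u 1 * w 1) * hT 1 1 + (u 1 * w 2) * hT 1 2 +
        (u 2 * w 0) * hT 2 0 + (u 2 * w 1) * hT 2 1 + (u 2 * w 2) * hT 2 2
    have hx : ∀ j, ∑ k, hess a x j k * x k = 0 := fun j => by
      rw [← hH j]
      exact Finset.sum_congr rfl fun k _ => by rw [hess_symm a x j k, mul_comm]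
    have k1 := key v v
    have k2 := key x v
    have k3 := key x x
    simp only [hv.1, hx, mul_zero, Finset.sum_const_zero] at k1 k2 k3
    have h3 := hv.2
    have a1 := s1 1 0
    have a2 := s1 2 0
    have a3 := s1 2 1
    have b1 := fun i => s2 i 1 0
    have b2 := fun i => s2 i 2 0
    have b3 := fun i => s2 i 2 1
    simp only [Fin.sum_univ_three, Pi.add_apply, Pi.smul_apply, smul_eq_mul, a1, a2, a3, b1, b2,
      b3] at *
    linear_combination c ^ 3 * h3 + 3 * c ^ 2 * e * k1 + 3 * c * e ^ 2 * k2 + e ^ 3 * k3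

lemma isSingularAt_mk {a : QuarticCoeff} (ha : a ≠ 0) {x : Fin 3 → ℂ} (hx : x ≠ 0) :
    IsSingularAt (Projectivization.mk ℂ a ha) (Projectivization.mk ℂ x hx) ↔ SingularVec a x := by
  obtain ⟨b, hb⟩ := Projectivization.exists_smul_eq_mk_rep ℂ a ha
  obtain ⟨c, hc⟩ := Projectivization.exists_smul_eq_mk_rep ℂ x hx
  rw [IsSingularAt, ← hb, ← hc]
  exact singularVec_smul b.ne_zero c.ne_zero

lemma hasTacnodalDirection_mk {a : QuarticCoeff} (ha : a ≠ 0) {x : Fin 3 → ℂ} (hx : x ≠ 0) :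
    HasTacnodalDirection (Projectivization.mk ℂ a ha) (Projectivization.mk ℂ x hx) ↔
      ∃ v : Fin 3 → ℂ, v ∉ Submodule.span ℂ {x} ∧ TacnodalVec a x v := by
  obtain ⟨b, hb⟩ := Projectivization.exists_smul_eq_mk_rep ℂ a ha
  obtain ⟨c, hc⟩ := Projectivization.exists_smul_eq_mk_rep ℂ x hx
  rw [HasTacnodalDirection, Projectivization.submodule_mk, ← hb, ← hc]
  exact exists_congr fun v => and_congr_right fun _ => tacnodalVec_smul b.ne_zero c.ne_zero

end PlaneQuartic

end

noncomputable section

namespace PlaneQuartic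

open MvPolynomial

/-! ### Generic points and their derivations -/

/-! A limit of binodal quartics is tacnodal when the two nodes collide. Write the second node as x +
t v with v on the unit sphere and t → 0. The Taylor expansions of the quartic and its gradient
terminate, and they show that the Hessian applied to v is O(t) and that the cubic term along v is
exactly -12 t s_a(v). Compactness of the sphere gives a limiting direction
(`tacnodalVec_of_tendsto`, `exists_tacnodalVec_of_mem_closure`). If the nodes stay apart in the
limit, the limit is still binodal, because being singular is a closed condition.

Conversely, after a permutation of coordinates a tacnodal quartic has the form `tacForm θ` with θ in
ℂ^12: nine coefficients, two coordinates of the point and one slope (`exists_adapted_parameters`).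
It has an explicit deformation `binForm θ t` with nodes at adapted coordinates (0, 0, 1) and (t, 0,
1). The deformation must keep passing through the eleven points. If the eleven evaluations have
independent θ-derivatives, then (θ, t) ↦ (evaluations, t) is a submersion, so there are nearby
solutions with t ≠ 0 (`mem_closure_binForm`).

It remains to exclude dependent derivatives for general points. By elimination, either a nonzero
polynomial in the points vanishes wherever such a degeneracy occurs, or there is a degenerate
solution over a finite extension of the function field of the points, where the points can be
differentiated freely (`exists_vanishing_or_generic_point`). The second case is impossible
(`false_of_generic`): a dependency makes some point w i₀ singular on the quartic. A parameter count
(33 coordinates plus scaling against 12 parameters, each point moving in at most 2 dimensions on a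
fixed curve) shows that all θ-derivatives vanish at w i₀. So w i₀ is the tacnode itself, moves in
only 1 dimension, and the count fails: 34 > 12 + 21. -/

lemma exists_derivations_of_formallyEtale {k ι Ω : Type*} [Fintype ι] [CommRing k] [CommRing Ω]
    [Algebra k Ω] [Algebra (MvPolynomial ι k) Ω] [IsScalarTower k (MvPolynomial ι k) Ω]
    [Algebra.FormallyEtale (MvPolynomial ι k) Ω] :
    ∃ 𝒟 : (ι → Ω) →ₗ[Ω] Derivation k Ω Ω,
      ∀ q i, 𝒟 q (algebraMap (MvPolynomial ι k) Ω (X i)) = q i := by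
  classical
  let R := MvPolynomial ι k
  -- Formal étaleness identifies the differentials of Ω over k with the base change of those of R,
  -- so a derivation R → Ω with prescribed values on the variables extends to Ω.
  have key : ∀ q : ι → Ω, ∃ d : Derivation k Ω Ω, ∀ i, d (algebraMap R Ω (X i)) = q i := by
    intro q
    let d₀ : Derivation k R Ω := mkDerivation k q
    let e := KaehlerDifferential.tensorKaehlerEquivOfFormallyEtale k R Ω
    let l : TensorProduct R Ω (Ω[R⁄k]) →ₗ[Ω] Ω :=
      TensorProduct.AlgebraTensorModule.lift
        ((LinearMap.toSpanSingleton Ω (Ω[R⁄k] →ₗ[R] Ω) d₀.liftKaehlerDifferential))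
    refine ⟨(l ∘ₗ e.symm.toLinearMap).compDer (KaehlerDifferential.D k Ω), fun i => ?_⟩
    have h := KaehlerDifferential.tensorKaehlerEquivOfFormallyEtale_symm_D_algebraMap k R Ω (X i)
    simp only [LinearMap.compDer, Derivation.mk_coe, LinearMap.coe_comp, Function.comp_apply,
      LinearMap.coe_mk, AddHom.coe_mk]
    change l (e.symm _) = _
    erw [h]
    simp only [l, d₀, TensorProduct.AlgebraTensorModule.lift_tmul, LinearMap.toSpanSingleton_apply,
      one_smul, Derivation.liftKaehlerDifferential_comp_D]
    exact mkDerivation_X k q i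
  -- Only the coordinate directions are chosen; combining them makes the extension linear in q.
  choose d hd using fun i => key (Pi.single i 1)
  refine ⟨Fintype.linearCombination Ω d, fun q i => ?_⟩
  have hsum : (∑ j, q j • d j) (algebraMap R Ω (X i)) =
      ∑ j, (q j • d j) (algebraMap R Ω (X i)) :=
    map_sum (Pi.evalAddMonoidHom _ (algebraMap R Ω (X i)) |>.comp
      (Derivation.coeFnAddMonoidHom (R := k) (A := Ω) (M := Ω))) _ _
  rw [Fintype.linearCombination_apply]
  refine hsum.trans ?_
  rw [Finset.sum_eq_single i]
  · simp [hd]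
  · intro j _ hj
    simp [hd, hj.symm]
  · simp

/-- The dichotomy is whether the equations generate the unit ideal over the function field of the
w-space. If they do not, a residue field of the quotient supplies a solution at the generic w. This
replaces generic smoothness by differentiation in a field. -/
theorem exists_vanishing_or_generic_point {k ι τ : Type} [Field k] [CharZero k] [Fintype ι]
    [Finite τ] (G : Set (MvPolynomial τ (MvPolynomial ι k))) :
    (∃ F : MvPolynomial ι k, F ≠ 0 ∧
      ∀ w y, (∀ g ∈ G, eval₂ (eval w) y g = 0) → eval w F = 0) ∨
    ∃ (Ω : Type) (_ : Field Ω) (_ : Algebra k Ω) (w : ι → Ω) (y : τ → Ω)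
      (𝒟 : (ι → Ω) →ₗ[Ω] Derivation k Ω Ω), (∀ q i, 𝒟 q (w i) = q i) ∧
      ∀ g ∈ G, eval₂ (eval₂Hom (algebraMap k Ω) w) y g = 0 := by
  classical
  let R := MvPolynomial ι k
  let L := FractionRing R
  let I : Ideal (MvPolynomial τ L) := (Ideal.span G).map (MvPolynomial.map (algebraMap R L))
  by_cases hI : I = ⊤
  · left
    let M := nonZeroDivisors R
    let : Algebra (MvPolynomial τ R) (MvPolynomial τ L) := algebraMvPolynomial
    have h1 : (1 : MvPolynomial τ L) ∈ (Ideal.span G).map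
        (algebraMap (MvPolynomial τ R) (MvPolynomial τ L)) := by
      have : (1 : MvPolynomial τ L) ∈ I := hI ▸ Submodule.mem_top
      exact this
    -- Clearing denominators in 1 ∈ I leaves a nonzero F, free of the variables in τ, in the ideal
    -- generated by G.
    rw [IsLocalization.mem_map_algebraMap_iff (M.map (C (σ := τ)))] at h1
    obtain ⟨⟨⟨x, hx⟩, ⟨s, hs⟩⟩, h⟩ := h1
    obtain ⟨F, hF, rfl⟩ := hs
    have hxF : x = C F := by
      have hinj : Function.Injective (MvPolynomial.map (σ := τ) (algebraMap R L)) :=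
        MvPolynomial.map_injective _ (IsFractionRing.injective R L)
      apply hinj
      rw [map_C]
      simpa only [algebraMap_def, one_mul, map_C] using h.symm
    refine ⟨F, nonZeroDivisors.ne_zero hF, fun w y hw => ?_⟩
    have hle : Ideal.span G ≤ RingHom.ker (eval₂Hom (eval w) y) :=
      Ideal.span_le.2 fun g hg => hw g hg
    have := hle hx
    rw [hxF] at this
    simpa using this
  · right
    obtain ⟨m, hm, hIm⟩ := Ideal.exists_le_maximal I hI
    obtain ⟨Ω, hΩ, φ, hφ, hI0⟩ : ∃ (Ω : Type) (_ : Field Ω) (φ : MvPolynomial τ L →+* Ω),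
        Function.Surjective φ ∧ ∀ g ∈ I, φ g = 0 :=
      ⟨MvPolynomial τ L ⧸ m, Ideal.Quotient.field m, Ideal.Quotient.mk m,
        Ideal.Quotient.mk_surjective, fun g hg => Ideal.Quotient.eq_zero_iff_mem.2 (hIm hg)⟩
    let : Algebra L Ω := (φ.comp C).toAlgebra
    have : Algebra.FiniteType L Ω := by
      let φ' : MvPolynomial τ L →ₐ[L] Ω := { φ with commutes' := fun _ => rfl }
      exact Algebra.FiniteType.of_surjective φ' hφ
    -- Zariski's lemma. In characteristic zero the finite extension is separable, hence étale over
    -- L, and so formally étale over the polynomial ring R.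
    have : Module.Finite L Ω := finite_of_finite_type_of_isJacobsonRing L Ω
    have : CharZero L := inferInstance
    have : Algebra.IsAlgebraic L Ω := inferInstance
    have : Algebra.IsSeparable L Ω := inferInstance
    have : Algebra.FormallyEtale L Ω := Algebra.FormallyEtale.of_isSeparable L Ω
    have : Algebra.FormallyEtale R L := Algebra.FormallyEtale.of_isLocalization (nonZeroDivisors R)
    let : Algebra R Ω := ((algebraMap L Ω).comp (algebraMap R L)).toAlgebra
    have : IsScalarTower R L Ω := IsScalarTower.of_algebraMap_eq fun _ => rfl
    have : Algebra.FormallyEtale R Ω := Algebra.FormallyEtale.comp R L Ω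
    let : Algebra k Ω := ((algebraMap R Ω).comp (algebraMap k R)).toAlgebra
    have : IsScalarTower k R Ω := IsScalarTower.of_algebraMap_eq fun _ => rfl
    obtain ⟨𝒟, h𝒟⟩ := exists_derivations_of_formallyEtale (k := k) (ι := ι) (Ω := Ω)
    refine ⟨Ω, inferInstance, inferInstance, fun i => algebraMap R Ω (X i),
      fun t => φ (X t), 𝒟, h𝒟, fun g hg => ?_⟩
    have h1 : (eval₂Hom (algebraMap k Ω) fun i => algebraMap R Ω (X i)) = algebraMap R Ω := by
      apply MvPolynomial.ringHom_ext
      · intro i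
        rw [coe_eval₂Hom, eval₂_C]
        rfl
      · intro i
        rw [coe_eval₂Hom, eval₂_X]
    have h2 : (eval₂Hom (algebraMap R Ω) fun t => φ (X t)) =
        φ.comp (MvPolynomial.map (algebraMap R L)) := by
      apply MvPolynomial.ringHom_ext
      · intro i
        rw [coe_eval₂Hom, eval₂_C, RingHom.comp_apply, map_C]
        rfl
      · intro i
        rw [coe_eval₂Hom, eval₂_X, RingHom.comp_apply, map_X]
    rw [h1]
    have h3 := congrArg (fun f => f g) h2
    simp only [coe_eval₂Hom, RingHom.comp_apply] at h3
    rw [h3]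
    exact hI0 _ (Ideal.mem_map_of_mem _ (Ideal.subset_span hg))

/-! ### Multihomogeneity -/

/-- Scaling the i-th vector by its own variable X i records the multidegree of each monomial in the
exponent of X. -/
lemma coeff_scale {n : ℕ} (w : Fin n × Fin 3 → ℂ) (d : Fin n →₀ ℕ)
    (F : MvPolynomial (Fin n × Fin 3) ℂ) :
    coeff d (aeval (fun q => C (w q) * X q.1 : Fin n × Fin 3 → MvPolynomial (Fin n) ℂ) F) =
      eval w (weightedHomogeneousComponent (fun q => Finsupp.single q.1 1) d F) := by
  classical
  induction F using MvPolynomial.induction_on' with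
  | add p q hp hq => rw [map_add, map_add, map_add, coeff_add, hp, hq]
  | monomial m a =>
    have h1 : aeval (fun q => C (w q) * X q.1 : Fin n × Fin 3 → MvPolynomial (Fin n) ℂ)
        (monomial m a) = monomial (Finsupp.weight
          (fun q : Fin n × Fin 3 => Finsupp.single q.1 1) m) (eval w (monomial m a)) := by
      rw [aeval_monomial, eval_monomial, Finsupp.weight_apply]
      simp only [mul_pow, Finsupp.prod, Finsupp.sum, Finset.prod_mul_distrib]
      rw [← C_mul_monomial, algebraMap_eq]
      congr 1
      rw [← mul_one (∏ x ∈ m.support, w x ^ m x), ← C_mul_monomial, monomial_sum_one]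
      simp [X_pow_eq_monomial]
    rw [h1, coeff_monomial]
    split_ifs with h
    · rw [(isWeightedHomogeneous_monomial _ m a h).weightedHomogeneousComponent_same]
    · rw [(isWeightedHomogeneous_monomial _ m a rfl).weightedHomogeneousComponent_ne _ (Ne.symm h)]
      simp

/-- F need not be multihomogeneous: one nonzero multihomogeneous component suffices. Where that
component does not vanish, F itself is nonzero after rescaling the vectors by suitable nonzero t i,
and this does not move the points. -/
theorem forGeneralPoints_of_vectors {n : ℕ} {P : (Fin n → P2) → Prop}
    (F : MvPolynomial (Fin n × Fin 3) ℂ) (hF : F ≠ 0)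
    (h : ∀ (w : Fin n × Fin 3 → ℂ) (hw : ∀ i, (fun l => w (i, l)) ≠ 0), eval w F ≠ 0 →
      P fun i => Projectivization.mk ℂ (fun l => w (i, l)) (hw i)) :
    ForGeneralPoints n P := by
  classical
  obtain ⟨m, hm⟩ := ne_zero_iff.1 hF
  set wt : Fin n × Fin 3 → (Fin n →₀ ℕ) := fun q => Finsupp.single q.1 1 with hwt
  set d := Finsupp.weight wt m with hd
  refine ⟨weightedHomogeneousComponent wt d F, ?_, ⟨d, fun i => ?_⟩, fun p hp => ?_⟩
  · refine ne_zero_iff.2 ⟨m, ?_⟩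
    rwa [coeff_weightedHomogeneousComponent, if_pos rfl]
  · intro m' hm'
    have h1 := weightedHomogeneousComponent_isWeightedHomogeneous (w := wt) d F hm'
    rw [← h1, Finsupp.weight_apply, Finsupp.weight_apply, Finsupp.sum, Finsupp.sum,
      Finsupp.finsetSum_apply]
    refine Finset.sum_congr rfl fun q _ => ?_
    simp [hwt, Finsupp.single_apply]
  · rw [← coeff_scale] at hp
    set G := aeval (fun q => C ((p q.1).rep q.2) * X q.1 :
      Fin n × Fin 3 → MvPolynomial (Fin n) ℂ) F with hG
    have hG0 : G ≠ 0 := fun h0 => hp (by rw [h0, coeff_zero])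
    have hG1 : G * ∏ i, X i ≠ 0 := mul_ne_zero hG0 (Finset.prod_ne_zero_iff.2 fun i _ => X_ne_zero i)
    obtain ⟨t, ht⟩ : ∃ t, eval t (G * ∏ i, X i) ≠ 0 := by
      by_contra! hc
      exact hG1 (MvPolynomial.funext fun t => by simpa using hc t)
    rw [map_mul, map_prod, mul_ne_zero_iff, Finset.prod_ne_zero_iff] at ht
    have ht0 : ∀ i, t i ≠ 0 := fun i => by simpa using ht.2 i (Finset.mem_univ i)
    have hw : ∀ i, (fun l => t i * (p i).rep l) ≠ 0 := fun i h0 =>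
      (p i).rep_nonzero (by
        ext l
        have := congrFun h0 l
        simpa [ht0 i] using this)
    have hev : eval t G = eval (fun q => t q.1 * (p q.1).rep q.2) F := by
      have : (eval t).comp (aeval (fun q => C ((p q.1).rep q.2) * X q.1 :
          Fin n × Fin 3 → MvPolynomial (Fin n) ℂ)).toRingHom =
          eval (fun q => t q.1 * (p q.1).rep q.2) := by
        apply MvPolynomial.ringHom_ext <;> intro q <;> simp [mul_comm, algebraMap_eq]
      exact congrArg (fun f => f F) this
    have := h (fun q => t q.1 * (p q.1).rep q.2) hw (hev ▸ ht.1)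
    convert this using 2 with i
    conv_lhs => rw [← (p i).mk_rep]
    rw [Projectivization.mk_eq_mk_iff']
    exact ⟨(t i)⁻¹, by ext l; simp [ht0 i]⟩

/-! ### Quartic forms with a tacnode in normal position

A vector `θ` of twelve parameters stands for a quartic with tacnodal direction `(1, θ 11, 0)` at
the point `(θ 9, θ 10, 1)`; its first nine entries are the coefficients in adapted coordinates. -/

section Families

variable {S : Type*} [CommRing S]

/-- The first adapted coordinate. -/
def adaptedX (θ : Fin 12 → S) (Y : Fin 3 → S) : S := Y 0 - θ 9 * Y 2

/-- The second adapted coordinate; the third one is `Y 2`. -/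
def adaptedY (θ : Fin 12 → S) (Y : Fin 3 → S) : S := Y 1 - θ 10 * Y 2 - θ 11 * adaptedX θ Y

/-- The general quartic form with tacnodal direction `(1, 0, 0)` at `(0, 0, 1)`. -/
def tac (θ : Fin 12 → S) (x y z : S) : S :=
  θ 0 * x ^ 4 + θ 1 * (x ^ 3 * y) + θ 2 * (x ^ 2 * y ^ 2) + θ 3 * (x * y ^ 3) + θ 4 * y ^ 4 +
    θ 5 * (x ^ 2 * y * z) + θ 6 * (x * y ^ 2 * z) + θ 7 * (y ^ 3 * z) + θ 8 * (y ^ 2 * z ^ 2)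

/-- The `x`-derivative of `tac`. -/
def tacX (θ : Fin 12 → S) (x y z : S) : S :=
  4 * θ 0 * x ^ 3 + 3 * θ 1 * (x ^ 2 * y) + 2 * θ 2 * (x * y ^ 2) + θ 3 * y ^ 3 +
    2 * θ 5 * (x * y * z) + θ 6 * (y ^ 2 * z)

/-- The `y`-derivative of `tac`. -/
def tacY (θ : Fin 12 → S) (x y z : S) : S :=
  θ 1 * x ^ 3 + 2 * θ 2 * (x ^ 2 * y) + 3 * θ 3 * (x * y ^ 2) + 4 * θ 4 * y ^ 3 +
    θ 5 * (x ^ 2 * z) + 2 * θ 6 * (x * y * z) + 3 * θ 7 * (y ^ 2 * z) + 2 * θ 8 * (y * z ^ 2)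

/-- The `z`-derivative of `tac`. -/
def tacZ (θ : Fin 12 → S) (x y z : S) : S :=
  θ 5 * (x ^ 2 * y) + θ 6 * (x * y ^ 2) + θ 7 * y ^ 3 + 2 * θ 8 * (y ^ 2 * z)

/-- The quartic form of the parameters `θ`. -/
def tacForm (θ : Fin 12 → S) (Y : Fin 3 → S) : S := tac θ (adaptedX θ Y) (adaptedY θ Y) (Y 2)

/-- The derivatives of `tacForm` with respect to the parameters. -/
def paramGrad (θ : Fin 12 → S) (Y : Fin 3 → S) : Fin 12 → S :=
  let x := adaptedX θ Y
  let y := adaptedY θ Y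
  let z := Y 2
  ![x ^ 4, x ^ 3 * y, x ^ 2 * y ^ 2, x * y ^ 3, y ^ 4, x ^ 2 * y * z, x * y ^ 2 * z, y ^ 3 * z,
    y ^ 2 * z ^ 2, -z * tacX θ x y z + θ 11 * z * tacY θ x y z, -z * tacY θ x y z,
    -x * tacY θ x y z]

/-- The derivatives of `tacForm` with respect to the point. -/
def pointGrad (θ : Fin 12 → S) (Y : Fin 3 → S) : Fin 3 → S :=
  let x := adaptedX θ Y
  let y := adaptedY θ Y
  let z := Y 2
  ![tacX θ x y z - θ 11 * tacY θ x y z, tacY θ x y z,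
    -θ 9 * tacX θ x y z + (θ 11 * θ 9 - θ 10) * tacY θ x y z + tacZ θ x y z]

lemma derivation_tac {k : Type*} [CommRing k] [Algebra k S] (D : Derivation k S S)
    (θ : Fin 12 → S) (x y z : S) :
    D (tac θ x y z) = tac (fun i => D (θ i)) x y z +
      tacX θ x y z * D x + tacY θ x y z * D y + tacZ θ x y z * D z := by
  simp only [tac, tacX, tacY, tacZ, map_add, Derivation.leibniz, Derivation.leibniz_pow,
    smul_eq_mul, nsmul_eq_mul]
  push_cast
  ring

/-- The chain rule, stated for arbitrary derivations so that it serves both at the generic point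
and, through the formal derivative of polynomials, in `hasDerivAt_tacForm`. -/
lemma derivation_tacForm {k : Type*} [CommRing k] [Algebra k S] (D : Derivation k S S)
    (θ : Fin 12 → S) (Y : Fin 3 → S) :
    D (tacForm θ Y) = ∑ i, paramGrad θ Y i * D (θ i) + ∑ l, pointGrad θ Y l * D (Y l) := by
  rw [tacForm, derivation_tac]
  simp only [Fin.sum_univ_succ, Fin.sum_univ_zero, paramGrad, pointGrad]
  simp only [tac, adaptedX, adaptedY, map_sub, Derivation.leibniz, smul_eq_mul, Fin.isValue]
  simp [Fin.succ_zero_eq_one]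
  ring

variable {S' : Type*} [CommRing S'] (φ : S →+* S')

lemma map_tacForm (θ : Fin 12 → S) (Y : Fin 3 → S) :
    φ (tacForm θ Y) = tacForm (fun i => φ (θ i)) (fun l => φ (Y l)) := by
  simp [tacForm, tac, adaptedX, adaptedY]

lemma map_paramGrad (θ : Fin 12 → S) (Y : Fin 3 → S) (i : Fin 12) :
    φ (paramGrad θ Y i) = paramGrad (fun i => φ (θ i)) (fun l => φ (Y l)) i := by
  fin_cases i <;> simp [paramGrad, tacX, tacY, adaptedX, adaptedY, map_ofNat]

end Families

/-! ### A generic tuple of points imposes independent conditions on tacnodal quartics -/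

lemma derivation_eval {k K σ : Type*} [CommRing k] [CommRing K] [Algebra k K] [Fintype σ]
    (D : Derivation k K K) (w : σ → K) (g : MvPolynomial σ K) :
    ∃ g' : MvPolynomial σ K, (∀ m, coeff m g' = D (coeff m g)) ∧
      D (eval w g) = eval w g' + ∑ l, eval w (pderiv l g) * D (w l) := by
  classical
  induction g using MvPolynomial.induction_on with
  | C a =>
    refine ⟨C (D a), fun m => ?_, by simp⟩
    simp only [coeff_C]
    split_ifs <;> simp
  | add p q hp hq =>
    obtain ⟨p', hp1, hp2⟩ := hp
    obtain ⟨q', hq1, hq2⟩ := hq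
    refine ⟨p' + q', fun m => by simp [hp1, hq1], ?_⟩
    simp only [map_add, hp2, hq2, add_mul, Finset.sum_add_distrib]
    ring
  | mul_X p i hp =>
    obtain ⟨p', hp1, hp2⟩ := hp
    refine ⟨p' * X i, fun m => ?_, ?_⟩
    · simp only [coeff_mul_X']
      split_ifs <;> simp [hp1]
    · simp only [map_mul, Derivation.leibniz, hp2, eval_X, smul_eq_mul, pderiv_X, map_add,
        add_mul, Finset.sum_add_distrib]
      have : ∀ l, eval w (Pi.single (M := fun _ => MvPolynomial σ K) l 1 i) = if i = l then 1 else 0 := fun l => by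
        rw [Pi.single_apply]; split_ifs <;> simp
      simp only [this, mul_ite, mul_one, mul_zero, ite_mul, zero_mul, Finset.sum_ite_eq,
        Finset.mem_univ, if_true, mul_add, Finset.mul_sum, mul_assoc]
      ring

/-- If the gradient of g at w is nonzero, it is the functional. Otherwise w is a zero of every
partial derivative of g, one of which is a nonzero polynomial of smaller degree whose coefficients D
also scales by r; induct. The descent handles singular points and non-reduced curves. -/
lemma exists_functional_of_eval_eq_zero {k K σ : Type*} [CommRing k] [Field K] [CharZero K]
    [Algebra k K] [Fintype σ] (w : σ → K) (n : ℕ) (g : MvPolynomial σ K) (hn : g.totalDegree ≤ n)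
    (hg : g ≠ 0) (hw : eval w g = 0) :
    ∃ c : σ → K, c ≠ 0 ∧ ∀ (D : Derivation k K K) (r : K),
      (∀ m, D (coeff m g) = r * coeff m g) → ∑ l, c l * D (w l) = 0 := by
  classical
  induction n generalizing g with
  | zero =>
    have h := totalDegree_eq_zero_iff_eq_C.1 (Nat.le_zero.1 hn)
    rw [h] at hw hg
    simp only [eval_C] at hw
    simp [hw] at hg
  | succ n ih =>
    by_cases h : ∀ l, eval w (pderiv l g) = 0
    · obtain ⟨m, hm⟩ : ∃ m, coeff m g ≠ 0 ∧ m ≠ 0 := by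
        by_contra! hc
        have hgC : g = C (coeff 0 g) := by
          ext m
          rw [coeff_C]
          split_ifs with h0
          · rw [h0]
          · by_contra hne
            exact h0 (hc m hne).symm
        rw [hgC, eval_C] at hw
        exact hg (by rw [hgC, hw, C_0])
      obtain ⟨l, hl⟩ := Finsupp.ne_iff.1 hm.2
      simp only [Finsupp.coe_zero, Pi.zero_apply] at hl
      have hml : m - Finsupp.single l 1 + Finsupp.single l 1 = m :=
        tsub_add_cancel_of_le (Finsupp.single_le_iff.2 (Nat.one_le_iff_ne_zero.2 hl))
      have hgl : pderiv l g ≠ 0 := by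
        refine ne_zero_iff.2 ⟨m - Finsupp.single l 1, ?_⟩
        rw [coeff_pderiv, hml]
        exact mul_ne_zero hm.1 (Nat.cast_add_one_ne_zero _)
      have hdeg : (pderiv l g).totalDegree ≤ n := by
        refine Finset.sup_le fun s hs => ?_
        rw [mem_support_iff, coeff_pderiv] at hs
        have h1 := le_totalDegree (mem_support_iff.2 (left_ne_zero_of_mul hs))
        rw [Finsupp.sum_add_index' (by simp) (by simp)] at h1
        simp only [Finsupp.sum_single_index] at h1
        omega
      obtain ⟨c, hc, hc'⟩ := ih (pderiv l g) hdeg hgl (h l)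
      refine ⟨c, hc, fun D r hD => hc' D r fun m => ?_⟩
      have : D ((m l : K) + 1) = 0 := by
        have := D.map_natCast (m l + 1)
        push_cast at this
        exact this
      rw [coeff_pderiv, Derivation.leibniz, this, hD]
      simp only [smul_eq_mul]
      ring
    · push Not at h
      obtain ⟨l, hl⟩ := h
      refine ⟨fun l => eval w (pderiv l g), fun h0 => hl (congrFun h0 l), fun D r hD => ?_⟩
      obtain ⟨g', hg', h2⟩ := derivation_eval D w g
      have : g' = C r * g := by ext m; rw [hg', hD, coeff_C_mul]
      rw [hw, this, map_mul, hw] at h2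
      simpa using h2.symm

/-- Rank-nullity: by `h0` the kernel of T meets the scaling axis trivially, so it embeds in the
product of the U j. -/
lemma finrank_range_add_le {K M : Type*} [Field K] [AddCommGroup M] [Module K M]
    [FiniteDimensional K M] {n d : ℕ}
    (T : ((Fin n → Fin d → K) × K) →ₗ[K] M) (U : Fin n → Submodule K (Fin d → K))
    (hU : ∀ q r, T (q, r) = 0 → ∀ j, q j ∈ U j) (h0 : ∀ r, T (0, r) = 0 → r = 0) :
    n * d + 1 ≤ Module.finrank K M + ∑ j, Module.finrank K (U j) := by
  let f : LinearMap.ker T →ₗ[K] ((j : Fin n) → U j) :=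
    LinearMap.pi fun j => LinearMap.codRestrict (U j)
      (LinearMap.proj j ∘ₗ LinearMap.fst K _ _ ∘ₗ (LinearMap.ker T).subtype)
      fun z => hU z.1.1 z.1.2 z.2 j
  have hf : Function.Injective f := by
    rw [← LinearMap.ker_eq_bot, LinearMap.ker_eq_bot']
    rintro ⟨⟨q, r⟩, hz⟩ h
    have hq : q = 0 := by
      ext j : 1
      exact congrArg Subtype.val (congrFun h j)
    subst hq
    have := h0 r hz
    subst this
    rfl
  have h1 := LinearMap.finrank_le_finrank_of_injective hf
  rw [Module.finrank_pi_fintype] at h1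
  have h2 := T.finrank_range_add_finrank_ker
  have h3 := Submodule.finrank_le (LinearMap.range T)
  have h4 : Module.finrank K ((Fin n → Fin d → K) × K) = n * d + 1 := by
    simp [Module.finrank_prod, Module.finrank_pi_fintype]
  omega

/-- The exponents of the monomials in `tac`. -/
def tacExponents : Fin 9 → Fin 3 → ℕ :=
  ![![4, 0, 0], ![3, 1, 0], ![2, 2, 0], ![1, 3, 0], ![0, 4, 0], ![2, 1, 1], ![1, 2, 1], ![0, 3, 1],
    ![0, 2, 2]]

/-- The direction in parameter space that rescales the form. -/
def scaleDir {S : Type*} [CommRing S] (θ : Fin 12 → S) (i : Fin 12) : S :=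
  if i.1 < 9 then θ i else 0

lemma sum_paramGrad_mul_scaleDir {S : Type*} [CommRing S] (θ : Fin 12 → S) (Y : Fin 3 → S) :
    ∑ i, paramGrad θ Y i * scaleDir θ i = tacForm θ Y := by
  simp [Fin.sum_univ_succ, scaleDir, paramGrad, tacForm, tac, Fin.succ_zero_eq_one]
  ring

section GenericPoint

variable {k K : Type*} [CommRing k] [Field K] [CharZero K] [Algebra k K]

/-- If a derivation only rescales the quartic, a point on the quartic moves along a fixed curve, up
to its own scaling. The relation found in adapted coordinates is transported back to Y, using that D
kills θ 9, θ 10, θ 11. -/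
lemma exists_submodule_of_tacForm_eq_zero (θ : Fin 12 → K) (Y : Fin 3 → K)
    (hθ : ∃ i : Fin 9, θ (i.castLE (by norm_num)) ≠ 0) (hY : tacForm θ Y = 0) :
    ∃ V : Submodule K (Fin 3 → K), Module.finrank K V ≤ 2 ∧
      ∀ (D : Derivation k K K) (r : K), (∀ i, D (θ i) = r * scaleDir θ i) →
        (fun l => D (Y l)) ∈ V := by
  classical
  let g : MvPolynomial (Fin 3) K := ∑ i : Fin 9,
    monomial (Finsupp.equivFunOnFinite.symm (tacExponents i)) (θ (i.castLE (by norm_num)))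
  let u : Fin 3 → K := ![adaptedX θ Y, adaptedY θ Y, Y 2]
  have hinj : Function.Injective tacExponents := by decide
  have hcoeff : ∀ m, coeff m g = ∑ i : Fin 9,
      if Finsupp.equivFunOnFinite.symm (tacExponents i) = m then
        θ (i.castLE (by norm_num)) else 0 := fun m => by
    simp only [g, coeff_sum, coeff_monomial]
  have hg : g ≠ 0 := by
    obtain ⟨i, hi⟩ := hθ
    refine ne_zero_iff.2 ⟨Finsupp.equivFunOnFinite.symm (tacExponents i), ?_⟩
    rw [hcoeff, Finset.sum_eq_single i]
    · simpa using hi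
    · intro j _ hj
      rw [if_neg]
      exact fun h => hj (hinj (Finsupp.equivFunOnFinite.symm.injective h))
    · simp
  have hu : eval u g = 0 := by
    rw [← hY]
    simp [g, eval_monomial, Finsupp.prod_fintype, Fin.prod_univ_succ, Fin.sum_univ_succ,
      tacExponents, u, tacForm, tac, Fin.castLE]
    ring
  obtain ⟨c, hc, hc'⟩ := exists_functional_of_eval_eq_zero (k := k) u _ g le_rfl hg hu
  let f : Module.Dual K (Fin 3 → K) := Fintype.linearCombination K
    ![c 0 - θ 11 * c 1, c 1, c 2 - θ 9 * c 0 - (θ 10 - θ 11 * θ 9) * c 1]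
  have hf : f ≠ 0 := by
    intro h0
    have h := fun i => LinearMap.congr_fun h0 (Pi.single i 1)
    have h2 := h 0
    have h3 := h 1
    have h4 := h 2
    simp only [f, Fintype.linearCombination_apply_single, LinearMap.zero_apply] at h2 h3 h4
    simp at h2 h3 h4
    apply hc
    ext l
    fin_cases l
    · simpa [h3] using h2
    · exact h3
    · have : c 0 = 0 := by simpa [h3] using h2
      simpa [h3, this] using h4
  refine ⟨LinearMap.ker f, ?_, fun D r hD => ?_⟩
  · have := Module.Dual.finrank_ker_add_one_of_ne_zero hf
    rw [Module.finrank_fin_fun] at this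
    omega
  · have h9 : D (θ 9) = 0 := by simp [hD, scaleDir]
    have h10 : D (θ 10) = 0 := by simp [hD, scaleDir]
    have h11 : D (θ 11) = 0 := by simp [hD, scaleDir]
    have h := hc' D r fun m => by
      rw [hcoeff, map_sum, Finset.mul_sum]
      refine Finset.sum_congr rfl fun i _ => ?_
      split_ifs
      · simp [hD, scaleDir]
      · simp
    simp [Fin.sum_univ_three, u, adaptedX, adaptedY, h9, h10, h11] at h
    simp only [LinearMap.mem_ker, f, Fintype.linearCombination_apply]
    simp [Fin.sum_univ_three]
    linear_combination h

set_option maxHeartbeats 1000000 in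
/-- For generic points `w`, no member of the family of tacnodal quartics through all `w i` has
dependent parameter derivatives at the `w i`. -/
theorem false_of_generic (w : Fin 11 × Fin 3 → K)
    (𝒟 : (Fin 11 × Fin 3 → K) →ₗ[K] Derivation k K K) (h𝒟 : ∀ q i, 𝒟 q (w i) = q i)
    (θ : Fin 12 → K) (hθ : ∃ i : Fin 9, θ (i.castLE (by norm_num)) ≠ 0) (μ : Fin 11 → K)
    (hμ : ∃ i, μ i ≠ 0) (hw : ∀ i, tacForm θ (fun l => w (i, l)) = 0)
    (hJ : ∀ j, ∑ i, μ i * paramGrad θ (fun l => w (i, l)) j = 0) : False := by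
  classical
  have h1 : ∀ (D : Derivation k K K) i, ∑ j, paramGrad θ (fun l => w (i, l)) j * D (θ j) +
      ∑ l, pointGrad θ (fun l => w (i, l)) l * D (w (i, l)) = 0 := fun D i => by
    rw [← derivation_tacForm D θ fun l => w (i, l), hw, map_zero]
  -- Differentiate the equations in the direction of a single coordinate and combine with weights μ:
  -- the θ-terms cancel by `hJ`. Thus the quartic is singular at each w i with μ i ≠ 0.
  have h2 : ∀ i l, μ i * pointGrad θ (fun l => w (i, l)) l = 0 := by
    intro i l
    have hs : ∑ i', μ i' * (∑ j, paramGrad θ (fun l => w (i', l)) j *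
          𝒟 (Pi.single (i, l) 1) (θ j) + ∑ l', pointGrad θ (fun l => w (i', l)) l' *
          𝒟 (Pi.single (i, l) 1) (w (i', l'))) = 0 := by simp [h1]
    simp only [mul_add, Finset.sum_add_distrib, h𝒟] at hs
    have h3 : ∑ i', μ i' * (∑ j, paramGrad θ (fun l => w (i', l)) j *
          𝒟 (Pi.single (i, l) 1) (θ j)) = 0 := by
      simp only [Finset.mul_sum]
      rw [Finset.sum_comm]
      refine Finset.sum_eq_zero fun j _ => ?_
      simp only [← mul_assoc, ← Finset.sum_mul, hJ, zero_mul]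
    rw [h3, zero_add, Finset.sum_eq_single i, Finset.sum_eq_single l] at hs
    · simpa using hs
    · intro l' _ hl'
      simp [hl']
    · simp
    · intro i' _ hi'
      simp [hi']
    · simp
  obtain ⟨i₀, hi₀⟩ := hμ
  have hrow : ∀ D : Derivation k K K, ∑ j, paramGrad θ (fun l => w (i₀, l)) j * D (θ j) = 0 := by
    intro D
    have h3 : ∀ l, pointGrad θ (fun l => w (i₀, l)) l = 0 := fun l => by simpa [hi₀] using h2 i₀ l
    simpa [h3] using h1 D i₀
  choose V hV hDV using fun i =>
    exists_submodule_of_tacForm_eq_zero (k := k) θ (fun l => w (i, l)) hθ (hw i)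
  -- In the kernel of T, moving the points by q changes the quartic only by the scaling r.
  let T : ((Fin 11 → Fin 3 → K) × K) →ₗ[K] (Fin 12 → K) :=
    { toFun := fun z j => 𝒟 (fun p => z.1 p.1 p.2) (θ j) - z.2 * scaleDir θ j
      map_add' := fun z z' => by
        ext j
        have : (fun p : Fin 11 × Fin 3 => (z + z').1 p.1 p.2) =
          (fun p => z.1 p.1 p.2) + fun p => z'.1 p.1 p.2 := rfl
        rw [this, map_add]
        simp only [Derivation.add_apply, Pi.add_apply, Prod.snd_add]
        ring
      map_smul' := fun r z => by
        ext j
        have : (fun p : Fin 11 × Fin 3 => (r • z).1 p.1 p.2) = r • fun p => z.1 p.1 p.2 := rfl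
        rw [this, map_smul]
        simp only [Derivation.smul_apply, Pi.smul_apply, Prod.smul_snd, smul_eq_mul,
          RingHom.id_apply]
        ring }
  have hT : ∀ q r j, T (q, r) j = 𝒟 (fun p => q p.1 p.2) (θ j) - r * scaleDir θ j :=
    fun _ _ _ => rfl
  have hker : ∀ q r, T (q, r) = 0 → ∀ j, 𝒟 (fun p => q p.1 p.2) (θ j) = r * scaleDir θ j :=
    fun q r h j => sub_eq_zero.1 ((hT q r j).symm.trans (congrFun h j))
  have hTV : ∀ q r, T (q, r) = 0 → ∀ i, q i ∈ V i := fun q r h i => by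
    have := hDV i _ r (hker q r h)
    simpa only [h𝒟] using this
  have hT0 : ∀ r, T (0, r) = 0 → r = 0 := by
    intro r hr
    obtain ⟨i, hi⟩ := hθ
    have := hker 0 r hr (i.castLE (by norm_num))
    have h0 : (fun p : Fin 11 × Fin 3 => (0 : Fin 11 → Fin 3 → K) p.1 p.2) = 0 := rfl
    rw [h0, map_zero] at this
    simpa [scaleDir, hi] using this
  have hsum : ∑ i, Module.finrank K (V i) ≤ 22 :=
    (Finset.sum_le_card_nsmul Finset.univ _ 2 fun i _ => hV i).trans (by simp)
  -- 33 + 1 ≤ rank T + 11 · 2 forces rank 12.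
  have hsurj : LinearMap.range T = ⊤ := by
    have h := finrank_range_add_le T.rangeRestrict V
      (fun q r h => hTV q r (congrArg Subtype.val h)) (fun r h => hT0 r (congrArg Subtype.val h))
    apply Submodule.eq_top_of_finrank_eq
    have h' := Submodule.finrank_le (LinearMap.range T)
    rw [Module.finrank_fin_fun] at *
    omega
  -- The row at i₀ annihilates every derivative of θ by `hrow`, and the scaling direction because
  -- the quartic passes through w i₀; hence it annihilates the whole image of T.
  have hrow0 : ∀ j, paramGrad θ (fun l => w (i₀, l)) j = 0 := by
    intro j
    obtain ⟨⟨q, r⟩, hqr⟩ : Pi.single j 1 ∈ LinearMap.range T := hsurj ▸ Submodule.mem_top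
    have h3 : ∑ j', paramGrad θ (fun l => w (i₀, l)) j' * T (q, r) j' = 0 := by
      simp only [hT, mul_sub, Finset.sum_sub_distrib, hrow, mul_left_comm _ r, ← Finset.mul_sum,
        sum_paramGrad_mul_scaleDir, hw]
      simp
    rw [hqr] at h3
    simpa [Pi.single_apply] using h3
  have hx : adaptedX θ (fun l => w (i₀, l)) = 0 := by
    simpa [paramGrad] using hrow0 0
  have hy : adaptedY θ (fun l => w (i₀, l)) = 0 := by
    simpa [paramGrad] using hrow0 4
  -- The entries x ^ 4 and y ^ 4 of the row put w i₀ over the tacnode. In the kernel of T the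
  -- tacnode is fixed, so the allowed motions at i₀ shrink to a line.
  obtain ⟨V', hV'₀, hV'₁⟩ : ∃ V' : Fin 11 → Submodule K (Fin 3 → K),
      V' i₀ = Submodule.span K {![θ 9, θ 10, 1]} ∧ ∀ i ≠ i₀, V' i = V i :=
    ⟨Function.update V i₀ _, Function.update_self .., fun i hi => Function.update_of_ne hi ..⟩
  have hV' : ∀ q r, T (q, r) = 0 → ∀ i, q i ∈ V' i := by
    intro q r h i
    by_cases hi : i = i₀
    · subst hi
      rw [hV'₀]
      have hd := hker q r h
      have h9 := hd 9
      have h10 := hd 10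
      simp [scaleDir] at h9 h10
      have e0 : w (i, 0) = θ 9 * w (i, 2) := sub_eq_zero.1 hx
      have e1 : w (i, 1) = θ 10 * w (i, 2) := by
        rw [adaptedY, hx, mul_zero, sub_zero] at hy
        exact sub_eq_zero.1 hy
      have d0 := congrArg (𝒟 fun p => q p.1 p.2) e0
      have d1 := congrArg (𝒟 fun p => q p.1 p.2) e1
      simp only [Derivation.leibniz, h𝒟, h9, h10, smul_eq_mul, mul_zero, add_zero] at d0 d1
      refine Submodule.mem_span_singleton.2 ⟨q i 2, ?_⟩
      ext l
      fin_cases l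
      · simp [d0, mul_comm]
      · simp [d1, mul_comm]
      · simp
    · rw [hV'₁ i hi]
      exact hTV q r h i
  have h := finrank_range_add_le T V' hV' hT0
  have hsum' : ∑ i, Module.finrank K (V' i) ≤ 21 := by
    rw [← Finset.add_sum_erase _ _ (Finset.mem_univ i₀)]
    have h3 : Module.finrank K (V' i₀) ≤ 1 := by
      rw [hV'₀]
      exact (finrank_span_le_card _).trans_eq (by rw [Set.toFinset_singleton, Finset.card_singleton])
    have h4 : ∑ i ∈ Finset.univ.erase i₀, Module.finrank K (V' i) ≤ 20 := by
      refine (Finset.sum_le_card_nsmul _ _ 2 fun i hi => ?_).trans (by simp)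
      rw [hV'₁ i (Finset.ne_of_mem_erase hi)]
      exact hV i
    omega
  rw [Module.finrank_fin_fun] at h
  omega

end GenericPoint

/-- The condition that the parameters `θ` are those of a tacnodal quartic through the points `w i`
at which the evaluations at the `w i` have linearly dependent derivatives. -/
def IsDegenerate (w : Fin 11 × Fin 3 → ℂ) (θ : Fin 12 → ℂ) : Prop :=
  (∃ i : Fin 9, θ (i.castLE (by norm_num)) ≠ 0) ∧ (∀ i, tacForm θ (fun l => w (i, l)) = 0) ∧
    ∃ μ : Fin 11 → ℂ, (∃ i, μ i ≠ 0) ∧ ∀ j, ∑ i, μ i * paramGrad θ (fun l => w (i, l)) j = 0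

theorem exists_polynomial_of_isDegenerate :
    ∃ F : MvPolynomial (Fin 11 × Fin 3) ℂ, F ≠ 0 ∧ ∀ w θ, IsDegenerate w θ → eval w F = 0 := by
  classical
  let τ := Fin 12 ⊕ Fin 9 ⊕ Fin 11 ⊕ Fin 11
  let A := MvPolynomial τ (MvPolynomial (Fin 11 × Fin 3) ℂ)
  let θ : Fin 12 → A := fun i => X (.inl i)
  let c : Fin 9 → A := fun i => X (.inr (.inl i))
  let μ : Fin 11 → A := fun i => X (.inr (.inr (.inl i)))
  let e : Fin 11 → A := fun i => X (.inr (.inr (.inr i)))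
  let W : Fin 11 → Fin 3 → A := fun i l => C (X (i, l))
  -- The variables c and e are Rabinowitsch witnesses: the last two equations say that the nine
  -- coefficients, respectively the μ i, do not all vanish.
  let G : Set A := Set.range (fun i => tacForm θ (W i)) ∪
    (Set.range (fun j => ∑ i, μ i * paramGrad θ (W i) j) ∪
      {∑ i, c i * θ (i.castLE (by norm_num)) - 1, ∑ i, e i * μ i - 1})
  rcases exists_vanishing_or_generic_point G with ⟨F, hF, h⟩ | ⟨Ω, _, _, w, y, 𝒟, h𝒟, h⟩
  · refine ⟨F, hF, ?_⟩
    rintro w t ⟨⟨i₁, hi₁⟩, hw, m, ⟨i₂, hi₂⟩, hm⟩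
    refine h w (Sum.elim t (Sum.elim (Pi.single i₁ (t (i₁.castLE (by norm_num)))⁻¹)
      (Sum.elim m (Pi.single i₂ (m i₂)⁻¹)))) ?_
    set y := Sum.elim t (Sum.elim (Pi.single i₁ (t (i₁.castLE (by norm_num)))⁻¹)
      (Sum.elim m (Pi.single i₂ (m i₂)⁻¹)))
    have hθ : ∀ i, eval₂Hom (eval w) y (θ i) = t i := fun i => eval₂_X ..
    have hW : ∀ i l, eval₂Hom (eval w) y (W i l) = w (i, l) := fun i l => by simp [W]
    have hμ : ∀ i, eval₂Hom (eval w) y (μ i) = m i := fun i => eval₂_X ..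
    have hc : ∀ i, eval₂Hom (eval w) y (c i) =
      Pi.single (M := fun _ => ℂ) i₁ (t (i₁.castLE (by norm_num)))⁻¹ i := fun i => eval₂_X ..
    have he : ∀ i, eval₂Hom (eval w) y (e i) = Pi.single (M := fun _ => ℂ) i₂ (m i₂)⁻¹ i :=
      fun i => eval₂_X ..
    rintro g (⟨i, rfl⟩ | ⟨j, rfl⟩ | rfl | rfl)
    · change eval₂Hom (eval w) y _ = 0
      rw [map_tacForm]
      simp only [hθ, hW, hw]
    · change eval₂Hom (eval w) y _ = 0
      rw [map_sum]
      simp only [map_mul, map_paramGrad, hθ, hW, hμ, hm]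
    · change eval₂Hom (eval w) y _ = 0
      rw [map_sub, map_sum, map_one, sub_eq_zero, Finset.sum_eq_single i₁]
      · rw [map_mul, hc, hθ, Pi.single_eq_same, inv_mul_cancel₀ hi₁]
      · intro i _ hi
        rw [map_mul, hc, Pi.single_eq_of_ne hi, zero_mul]
      · simp
    · change eval₂Hom (eval w) y _ = 0
      rw [map_sub, map_sum, map_one, sub_eq_zero, Finset.sum_eq_single i₂]
      · rw [map_mul, he, hμ, Pi.single_eq_same, inv_mul_cancel₀ hi₂]
      · intro i _ hi
        rw [map_mul, he, Pi.single_eq_of_ne hi, zero_mul]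
      · simp
  · exfalso
    have : CharZero Ω := charZero_of_injective_algebraMap (algebraMap ℂ Ω).injective
    set φ := eval₂Hom (eval₂Hom (algebraMap ℂ Ω) w) y with hφ
    have hW : ∀ i l, φ (W i l) = w (i, l) := fun i l => by simp [W, hφ]
    have hG : ∀ g ∈ G, φ g = 0 := h
    have g1 : ∀ i, φ (tacForm θ (W i)) = 0 := fun i => hG _ (.inl ⟨i, rfl⟩)
    have g2 : ∀ j, φ (∑ i, μ i * paramGrad θ (W i) j) = 0 := fun j => hG _ (.inr (.inl ⟨j, rfl⟩))
    have g3 : φ (∑ i, c i * θ (i.castLE (by norm_num)) - 1) = 0 := hG _ (.inr (.inr (.inl rfl)))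
    have g4 : φ (∑ i, e i * μ i - 1) = 0 := hG _ (.inr (.inr (.inr rfl)))
    refine false_of_generic w 𝒟 h𝒟 (fun i => φ (θ i)) ?_ (fun i => φ (μ i)) ?_ ?_ ?_
    · by_contra! hc
      simp [map_sum, hc] at g3
    · by_contra! hc
      simp [map_sum, hc] at g4
    · intro i
      simpa only [map_tacForm, hW] using g1 i
    · intro j
      simpa only [map_sum, map_mul, map_paramGrad, hW] using g2 j

/-! ### Coordinates on the space of quartic forms -/

/-- The exponents of the quartic monomials. -/
def quarticExponents : Fin 15 → Fin 3 → ℕ :=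
  ![![4, 0, 0], ![3, 1, 0], ![2, 2, 0], ![1, 3, 0], ![0, 4, 0], ![2, 1, 1], ![1, 2, 1], ![0, 3, 1],
    ![0, 2, 2], ![2, 0, 2], ![1, 1, 2], ![3, 0, 1], ![0, 0, 4], ![1, 0, 3], ![0, 1, 3]]

lemma quarticExponents_mem (i : Fin 15) :
    quarticExponents i ∈ Finset.piAntidiag (Finset.univ : Finset (Fin 3)) 4 := by
  rw [Finset.mem_piAntidiag]
  refine ⟨?_, fun _ _ => Finset.mem_univ _⟩
  revert i
  decide

/-- An enumeration of the quartic monomials. -/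
def quarticEquiv : Fin 15 ≃
    {m : Fin 3 → ℕ // m ∈ Finset.piAntidiag (Finset.univ : Finset (Fin 3)) 4} :=
  Equiv.ofBijective (fun i => ⟨quarticExponents i, quarticExponents_mem i⟩) <| by
    constructor
    · intro i j h
      have h' : quarticExponents i = quarticExponents j := congrArg Subtype.val h
      revert i j
      decide
    · rintro ⟨m, hm⟩
      have hs := (Finset.mem_piAntidiag.1 hm).1
      rw [Fin.sum_univ_three] at hs
      have h : ∀ a b c : Fin 5, a.1 + b.1 + c.1 = 4 → ∃ i, quarticExponents i = ![a.1, b.1, c.1] := by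
        decide
      obtain ⟨i, hi⟩ := h ⟨m 0, by omega⟩ ⟨m 1, by omega⟩ ⟨m 2, by omega⟩ hs
      refine ⟨i, Subtype.ext ?_⟩
      change quarticExponents i = m
      rw [hi]
      ext l
      fin_cases l <;> rfl

lemma quarticEquiv_val (i : Fin 15) : (quarticEquiv i).1 = quarticExponents i := rfl

lemma form_eq_sum (a : QuarticCoeff) :
    form a = ∑ i, C (a (quarticEquiv i)) * ∏ l, X l ^ quarticExponents i l := by
  rw [form, Fintype.linearCombination_apply, ← quarticEquiv.sum_comp]
  simp only [smul_eq_C_mul, quarticEquiv_val]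

lemma eval_form (a : QuarticCoeff) (Y : Fin 3 → ℂ) :
    eval Y (form a) = ∑ i, a (quarticEquiv i) * ∏ l, Y l ^ quarticExponents i l := by
  simp [form_eq_sum]

lemma finrank_quarticCoeff : Module.finrank ℂ QuarticCoeff = 15 := by
  rw [Module.finrank_fintype_fun_eq_card, ← Fintype.card_congr quarticEquiv, Fintype.card_fin]

lemma eval_rep_mk_eq_zero_iff (a : QuarticCoeff) {x : Fin 3 → ℂ} (hx : x ≠ 0) :
    eval (Projectivization.mk ℂ x hx).rep (form a) = 0 ↔ eval x (form a) = 0 := by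
  obtain ⟨c, hc⟩ := Projectivization.exists_smul_eq_mk_rep ℂ x hx
  rw [← hc, Units.smul_def, eval_smul_of_isHomogeneous (form_isHomogeneous a)]
  simp

/-- The determinant of the values of eleven of the quartic monomials at eleven points. -/
def monomialDet : MvPolynomial (Fin 11 × Fin 3) ℂ :=
  (Matrix.of fun i j : Fin 11 =>
    ∏ l, (X (i, l) : MvPolynomial (Fin 11 × Fin 3) ℂ) ^
      quarticExponents (j.castLE (by norm_num)) l).det

lemma eval_monomialDet (w : Fin 11 × Fin 3 → ℂ) : eval w monomialDet =
    (Matrix.of fun i j : Fin 11 =>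
      ∏ l, w (i, l) ^ quarticExponents (j.castLE (by norm_num)) l).det := by
  rw [monomialDet, RingHom.map_det]
  congr 1
  ext i j
  simp

lemma monomialDet_ne_zero : monomialDet ≠ 0 := by
  intro h0
  -- At the points (1, 2^i, 2^(5i)) the matrix is a transposed Vandermonde matrix with nodes 2^(e₁ +
  -- 5 e₂), where e is the exponent vector. The nodes are distinct because each exponent is less
  -- than 5.
  have h := eval_monomialDet fun q => ![1, 2 ^ q.1.1, 2 ^ (5 * q.1.1)] q.2
  have hV : (Matrix.of fun i j : Fin 11 => ∏ l, (![1, 2 ^ i.1, 2 ^ (5 * i.1)] l : ℂ) ^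
      quarticExponents (j.castLE (by norm_num)) l) =
      (Matrix.vandermonde fun j : Fin 11 =>
        ((2 ^ (quarticExponents (j.castLE (by norm_num)) 1 +
          5 * quarticExponents (j.castLE (by norm_num)) 2) : ℕ) : ℂ)).transpose := by
    ext i j
    simp [Fin.prod_univ_three, Matrix.vandermonde_apply, ← pow_mul, ← pow_add]
    ring
  rw [h0, map_zero, hV, Matrix.det_transpose] at h
  refine Matrix.det_vandermonde_ne_zero_iff.2 (fun i j hij => ?_) h.symm
  have h1 := Nat.pow_right_injective le_rfl (Nat.cast_injective hij)
  clear hij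
  revert i j
  decide

lemma finrank_formsThrough_mk {w : Fin 11 × Fin 3 → ℂ} (hw : ∀ i, (fun l => w (i, l)) ≠ 0)
    (h : eval w monomialDet ≠ 0) :
    Module.finrank ℂ
      (formsThrough fun i => Projectivization.mk ℂ (fun l => w (i, l)) (hw i)) = 4 := by
  classical
  let T : QuarticCoeff →ₗ[ℂ] (Fin 11 → ℂ) :=
    LinearMap.pi fun i => (aeval fun l => w (i, l)).toLinearMap ∘ₗ form
  have hT : ∀ a i, T a i = eval (fun l => w (i, l)) (form a) := fun a i => by
    simp [T, aeval_eq_eval]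
  have hker : LinearMap.ker T =
      formsThrough fun i => Projectivization.mk ℂ (fun l => w (i, l)) (hw i) := by
    ext a
    simp only [LinearMap.mem_ker, funext_iff, hT, Pi.zero_apply]
    exact forall_congr' fun i => (eval_rep_mk_eq_zero_iff a (hw i)).symm
  -- Forms supported on the first eleven monomials already take all values at the points, so the
  -- kernel has dimension 15 - 11 = 4.
  have hrange : LinearMap.range T = ⊤ := by
    rw [LinearMap.range_eq_top]
    intro y
    rw [eval_monomialDet] at h
    set M := Matrix.of fun i j : Fin 11 =>
      ∏ l, w (i, l) ^ quarticExponents (j.castLE (by norm_num)) l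
    have hM : IsUnit M := M.isUnit_iff_isUnit_det.2 h.isUnit
    obtain ⟨c, hc⟩ := Matrix.mulVec_surjective_iff_isUnit.2 hM y
    refine ⟨fun m => if hj : (quarticEquiv.symm m).1 < 11 then c ⟨_, hj⟩ else 0, ?_⟩
    ext i
    rw [hT, eval_form, ← hc, Matrix.mulVec, dotProduct,
      Fin.sum_univ_add (a := 11) (b := 4) (fun j => _)]
    simp only [Equiv.symm_apply_apply]
    simp [M, Fin.castLE, Fin.castAdd, mul_comm]
  have := T.finrank_range_add_finrank_ker
  rw [hrange, finrank_top, finrank_quarticCoeff, Module.finrank_fin_fun, hker] at this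
  omega

/-! ### Linear changes of coordinates -/

lemma coeff_form (a : QuarticCoeff) (d : Fin 3 →₀ ℕ) :
    coeff d (form a) =
      if h : ⇑d ∈ Finset.piAntidiag (Finset.univ : Finset (Fin 3)) 4 then a ⟨d, h⟩ else 0 := by
  classical
  have hm : ∀ m : Fin 3 → ℕ, ∏ i, (X i : MvPolynomial (Fin 3) ℂ) ^ m i =
      monomial (Finsupp.equivFunOnFinite.symm m) 1 := fun m => by
    rw [monomial_eq, C_1, one_mul, Finsupp.prod_fintype _ _ (by simp)]
    rfl
  rw [form, Fintype.linearCombination_apply, coeff_sum]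
  simp only [coeff_smul, hm, coeff_monomial, smul_eq_mul, mul_ite, mul_one, mul_zero]
  split_ifs with h
  · rw [Finset.sum_eq_single ⟨d, h⟩]
    · simp
    · intro m _ hmd
      rw [if_neg]
      rintro rfl
      exact hmd rfl
    · simp
  · refine Finset.sum_eq_zero fun m _ => if_neg ?_
    rintro rfl
    exact h m.2

lemma form_injective : Function.Injective form := by
  intro a b h
  ext m
  have := congrArg (coeff (Finsupp.equivFunOnFinite.symm m.1)) h
  simpa [coeff_form, m.2] using this

lemma exists_form_eq {P : MvPolynomial (Fin 3) ℂ} (hP : P.IsHomogeneous 4) : ∃ a, form a = P := by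
  refine ⟨fun m => coeff (Finsupp.equivFunOnFinite.symm m.1) P, ?_⟩
  ext d
  rw [coeff_form]
  split_ifs with h
  · congr 1
    ext
    rfl
  · refine (hP.coeff_eq_zero fun hd => h ?_).symm
    rw [Finset.mem_piAntidiag]
    refine ⟨?_, fun _ _ => Finset.mem_univ _⟩
    rw [← hd, Finsupp.degree_eq_sum]

/-- Linear substitution in polynomials. -/
def linSubst (M : Matrix (Fin 3) (Fin 3) ℂ) : MvPolynomial (Fin 3) ℂ →ₐ[ℂ] MvPolynomial (Fin 3) ℂ :=
  aeval fun i => ∑ j, C (M i j) * X j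

lemma eval_linSubst (M : Matrix (Fin 3) (Fin 3) ℂ) (f : MvPolynomial (Fin 3) ℂ) (Y : Fin 3 → ℂ) :
    eval Y (linSubst M f) = eval (M.mulVec Y) f := by
  have : (eval Y).comp (linSubst M).toRingHom = eval (M.mulVec Y) := by
    apply MvPolynomial.ringHom_ext
    · intro r
      simp [linSubst, algebraMap_eq]
    · intro i
      simp [linSubst, Matrix.mulVec, dotProduct]
  exact congrArg (fun g => g f) this

lemma pderiv_linSubst (M : Matrix (Fin 3) (Fin 3) ℂ) (i : Fin 3) (f : MvPolynomial (Fin 3) ℂ) :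
    pderiv i (linSubst M f) = ∑ j, C (M j i) * linSubst M (pderiv j f) := by
  induction f using MvPolynomial.induction_on with
  | C a => simp [linSubst, algebraMap_eq]
  | add p q hp hq => simp only [map_add, hp, hq, mul_add, Finset.sum_add_distrib]
  | mul_X p k hp =>
    have hX : pderiv i (linSubst M (X k)) = C (M k i) := by
      simp [linSubst, pderiv_X, Pi.single_apply]
    have hX' : ∀ j, linSubst M (pderiv j (X k)) = if k = j then 1 else 0 := fun j => by
      rw [pderiv_X, Pi.single_apply]
      split_ifs <;> simp
    have hL : ∀ j, linSubst M (pderiv j (p * X k)) =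
        (if k = j then linSubst M p else 0) + linSubst M (X k) * linSubst M (pderiv j p) := by
      intro j
      rw [Derivation.leibniz, map_add, smul_eq_mul, smul_eq_mul, map_mul, map_mul, hX']
      split_ifs <;> simp
    rw [map_mul, Derivation.leibniz, hX, hp, smul_eq_mul, smul_eq_mul]
    simp only [hL, mul_add, Finset.sum_add_distrib, mul_ite, mul_zero, Finset.sum_ite_eq,
      Finset.mem_univ, if_true, Finset.mul_sum]
    generalize linSubst M p = P
    generalize linSubst M (X k) = Q
    rw [mul_comm P]
    congr 1
    refine Finset.sum_congr rfl fun j _ => ?_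
    generalize linSubst M (pderiv j p) = R
    exact mul_left_comm _ _ _

lemma isHomogeneous_linSubst_form (M : Matrix (Fin 3) (Fin 3) ℂ) (a : QuarticCoeff) :
    (linSubst M (form a)).IsHomogeneous 4 := by
  have := (form_isHomogeneous a).aeval (fun i => ∑ j, C (M i j) * X j) (n := 1) fun i =>
    IsHomogeneous.sum _ _ _ fun j _ => by
      simpa using (isHomogeneous_C (Fin 3) (M i j)).mul (isHomogeneous_X ℂ j)
  rwa [one_mul] at this

/-- The quartic form composed with a linear map. -/
def pull (M : Matrix (Fin 3) (Fin 3) ℂ) (a : QuarticCoeff) : QuarticCoeff :=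
  (exists_form_eq (isHomogeneous_linSubst_form M a)).choose

lemma form_pull (M : Matrix (Fin 3) (Fin 3) ℂ) (a : QuarticCoeff) :
    form (pull M a) = linSubst M (form a) :=
  (exists_form_eq (isHomogeneous_linSubst_form M a)).choose_spec

lemma eval_form_pull (M : Matrix (Fin 3) (Fin 3) ℂ) (a : QuarticCoeff) (Y : Fin 3 → ℂ) :
    eval Y (form (pull M a)) = eval (M.mulVec Y) (form a) := by
  rw [form_pull, eval_linSubst]

lemma grad_pull (M : Matrix (Fin 3) (Fin 3) ℂ) (a : QuarticCoeff) (Y : Fin 3 → ℂ) (i : Fin 3) :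
    grad (pull M a) Y i = ∑ j, M j i * grad a (M.mulVec Y) j := by
  simp only [grad, form_pull, pderiv_linSubst, map_sum, map_mul, eval_C, eval_linSubst]

lemma hess_pull (M : Matrix (Fin 3) (Fin 3) ℂ) (a : QuarticCoeff) (Y : Fin 3 → ℂ) (i j : Fin 3) :
    hess (pull M a) Y i j = ∑ l, ∑ k, M l j * M k i * hess a (M.mulVec Y) k l := by
  simp only [hess, form_pull, pderiv_linSubst, map_sum, pderiv_C_mul, map_mul, eval_C,
    eval_linSubst, Finset.mul_sum, mul_assoc]

lemma third_pull (M : Matrix (Fin 3) (Fin 3) ℂ) (a : QuarticCoeff) (Y : Fin 3 → ℂ)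
    (i j k : Fin 3) : third (pull M a) Y i j k =
      ∑ n, ∑ m, ∑ l, M n k * M m j * M l i * third a (M.mulVec Y) l m n := by
  simp only [third, form_pull, pderiv_linSubst, map_sum, pderiv_C_mul, map_mul, eval_C,
    eval_linSubst, Finset.mul_sum, mul_assoc]

lemma SingularVec.pull {M : Matrix (Fin 3) (Fin 3) ℂ} {a : QuarticCoeff} {Y : Fin 3 → ℂ}
    (h : SingularVec a (M.mulVec Y)) : SingularVec (pull M a) Y := by
  refine ⟨by rw [eval_form_pull, h.1], fun i => ?_⟩
  simp [grad_pull, h.2]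

lemma TacnodalVec.pull {M : Matrix (Fin 3) (Fin 3) ℂ} {a : QuarticCoeff} {Y v : Fin 3 → ℂ}
    (h : TacnodalVec a (M.mulVec Y) (M.mulVec v)) : TacnodalVec (pull M a) Y v := by
  constructor
  · intro i
    have h1 := h.1
    simp only [hess_pull]
    simp only [Matrix.mulVec, dotProduct, Fin.sum_univ_three] at h1 ⊢
    linear_combination M 0 i * h1 0 + M 1 i * h1 1 + M 2 i * h1 2
  · rw [← h.2]
    have sc : ∀ F : Fin 3 → Fin 3 → Fin 3 → Fin 3 → ℂ,
        ∑ i, ∑ j, ∑ k, ∑ z, F i j k z = ∑ z, ∑ i, ∑ j, ∑ k, F i j k z := fun F =>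
      (Finset.sum_congr rfl fun i _ =>
        (Finset.sum_congr rfl fun j _ => Finset.sum_comm).trans Finset.sum_comm).trans
          Finset.sum_comm
    have sr : ∀ F : Fin 3 → Fin 3 → Fin 3 → ℂ,
        ∑ n, ∑ m, ∑ l, F l m n = ∑ l, ∑ m, ∑ n, F l m n := fun F => by
      simp only [Fin.sum_univ_three]
      ring
    simp only [third_pull, Finset.sum_mul]
    rw [sc]
    refine Eq.trans ?_ (sr _)
    refine Finset.sum_congr rfl fun n _ => ?_
    rw [sc]
    refine Finset.sum_congr rfl fun m _ => ?_
    rw [sc]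
    refine Finset.sum_congr rfl fun l _ => ?_
    generalize third a (M.mulVec Y) l m n = T
    simp only [Matrix.mulVec, dotProduct, Fin.sum_univ_three]
    ring

/-! ### Normal form of a tacnodal quartic -/

lemma form_eq (b : QuarticCoeff) : form b =
    C (b (quarticEquiv 0)) * X 0 ^ 4 + C (b (quarticEquiv 1)) * (X 0 ^ 3 * X 1) +
    C (b (quarticEquiv 2)) * (X 0 ^ 2 * X 1 ^ 2) + C (b (quarticEquiv 3)) * (X 0 * X 1 ^ 3) +
    C (b (quarticEquiv 4)) * X 1 ^ 4 + C (b (quarticEquiv 5)) * (X 0 ^ 2 * X 1 * X 2) +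
    C (b (quarticEquiv 6)) * (X 0 * X 1 ^ 2 * X 2) + C (b (quarticEquiv 7)) * (X 1 ^ 3 * X 2) +
    C (b (quarticEquiv 8)) * (X 1 ^ 2 * X 2 ^ 2) + C (b (quarticEquiv 9)) * (X 0 ^ 2 * X 2 ^ 2) +
    C (b (quarticEquiv 10)) * (X 0 * X 1 * X 2 ^ 2) + C (b (quarticEquiv 11)) * (X 0 ^ 3 * X 2) +
    C (b (quarticEquiv 12)) * X 2 ^ 4 + C (b (quarticEquiv 13)) * (X 0 * X 2 ^ 3) +
    C (b (quarticEquiv 14)) * (X 1 * X 2 ^ 3) := by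
  rw [form_eq_sum]
  simp [Fin.sum_univ_succ, Fin.prod_univ_three, quarticExponents, -Fin.isValue]
  ring

/-- Indices 12, 13, 14 of `quarticExponents` are z ^ 4, x z ^ 3, y z ^ 3: the monomials of order at
most one at (0, 0, 1). -/
lemma SingularVec.coeff {b : QuarticCoeff} (h : SingularVec b ![0, 0, 1]) :
    b (quarticEquiv 12) = 0 ∧ b (quarticEquiv 13) = 0 ∧ b (quarticEquiv 14) = 0 := by
  have h0 := h.1
  have h1 := h.2 0
  have h2 := h.2 1
  rw [grad] at h1 h2
  simp [form_eq, pderiv_X, Derivation.leibniz, Derivation.leibniz_pow] at h0 h1 h2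
  exact ⟨h0, h1, h2⟩

/-- Indices 9, 10, 11 are x ^ 2 z ^ 2, x y z ^ 2, x ^ 3 z: the first two are seen by the Hessian
applied to the direction, the third by the cubic term. With the singularity condition only the nine
monomials of `tac` remain. -/
lemma TacnodalVec.coeff {b : QuarticCoeff} (h : TacnodalVec b ![0, 0, 1] ![1, 0, 0]) :
    b (quarticEquiv 9) = 0 ∧ b (quarticEquiv 10) = 0 ∧ b (quarticEquiv 11) = 0 := by
  have h0 := h.1 0
  have h1 := h.1 1
  have h2 := h.2
  simp [Fin.sum_univ_three] at h0 h1 h2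
  rw [hess] at h0 h1
  rw [third] at h2
  simp [form_eq, pderiv_X, Derivation.leibniz, Derivation.leibniz_pow] at h0 h1 h2
  have h3 : (pderiv 0 : Derivation ℂ (MvPolynomial (Fin 3) ℂ) (MvPolynomial (Fin 3) ℂ)) 2 = 0 :=
    (pderiv 0).map_natCast 2
  refine ⟨h0, h1, ?_⟩
  simpa [h0, h3] using h2

/-! ### The binodal deformation of a tacnodal quartic -/

/-- The binodal deformation of `tacForm θ`: a quartic form that is singular at the points with
adapted coordinates `(0, 0, 1)` and `(t, 0, 1)`. -/
def binForm {S : Type*} [CommRing S] (θ : Fin 12 → S) (t : S) (Y : Fin 3 → S) : S :=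
  tacForm θ Y + θ 0 * t ^ 2 * (adaptedX θ Y ^ 2 * Y 2 ^ 2) - 2 * θ 0 * t * (adaptedX θ Y ^ 3 * Y 2) -
    (θ 5 * t + θ 1 * t ^ 2) * (adaptedX θ Y * adaptedY θ Y * Y 2 ^ 2)

lemma binForm_zero {S : Type*} [CommRing S] (θ : Fin 12 → S) (Y : Fin 3 → S) :
    binForm θ 0 Y = tacForm θ Y := by
  simp [binForm]

/-- The matrix of the adapted coordinates, precomposed with a permutation of the coordinates. -/
def adaptedMatrix (s : Equiv.Perm (Fin 3)) (θ : Fin 12 → ℂ) : Matrix (Fin 3) (Fin 3) ℂ :=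
  !![1, 0, -θ 9; -θ 11, 1, θ 11 * θ 9 - θ 10; 0, 0, 1].submatrix id s.symm

/-- The inverse of `adaptedMatrix`. -/
def adaptedInverse (s : Equiv.Perm (Fin 3)) (θ : Fin 12 → ℂ) : Matrix (Fin 3) (Fin 3) ℂ :=
  !![1, 0, θ 9; θ 11, 1, θ 10; 0, 0, 1].submatrix s.symm id

lemma adaptedMatrix_mulVec (s : Equiv.Perm (Fin 3)) (θ : Fin 12 → ℂ) (Y : Fin 3 → ℂ) :
    (adaptedMatrix s θ).mulVec Y =
      ![adaptedX θ (Y ∘ s), adaptedY θ (Y ∘ s), Y (s 2)] := by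
  have h : (adaptedMatrix s θ).mulVec Y =
      (!![1, 0, -θ 9; -θ 11, 1, θ 11 * θ 9 - θ 10; 0, 0, 1] : Matrix _ _ ℂ).mulVec (Y ∘ s) := by
    rw [adaptedMatrix, Matrix.submatrix_mulVec_equiv]
    rfl
  rw [h]
  ext i
  fin_cases i <;> simp [Matrix.mulVec, dotProduct, Fin.sum_univ_three, adaptedX, adaptedY] <;> ring

lemma adaptedInverse_mulVec (s : Equiv.Perm (Fin 3)) (θ : Fin 12 → ℂ) (u : Fin 3 → ℂ) :
    (adaptedInverse s θ).mulVec u =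
      ![u 0 + θ 9 * u 2, θ 11 * u 0 + u 1 + θ 10 * u 2, u 2] ∘ s.symm := by
  have h : (adaptedInverse s θ).mulVec u =
      (!![1, 0, θ 9; θ 11, 1, θ 10; 0, 0, 1] : Matrix _ _ ℂ).mulVec u ∘ s.symm := rfl
  rw [h]
  congr 1
  ext i
  fin_cases i <;> simp [Matrix.mulVec, dotProduct, Fin.sum_univ_three]

lemma adaptedInverse_mulVec_adaptedMatrix (s : Equiv.Perm (Fin 3)) (θ : Fin 12 → ℂ)
    (Y : Fin 3 → ℂ) : (adaptedInverse s θ).mulVec ((adaptedMatrix s θ).mulVec Y) = Y := by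
  rw [adaptedInverse_mulVec, adaptedMatrix_mulVec]
  ext i
  obtain ⟨j, rfl⟩ := s.surjective i
  fin_cases j <;> simp [adaptedX, adaptedY]

lemma adaptedMatrix_mulVec_adaptedInverse (s : Equiv.Perm (Fin 3)) (θ : Fin 12 → ℂ)
    (u : Fin 3 → ℂ) : (adaptedMatrix s θ).mulVec ((adaptedInverse s θ).mulVec u) = u := by
  rw [adaptedInverse_mulVec, adaptedMatrix_mulVec]
  ext j
  fin_cases j <;> simp [adaptedX, adaptedY]

/-- The coefficients of `binForm` in adapted coordinates. -/
def binCoeffAdapted (θ : Fin 12 → ℂ) (t : ℂ) : QuarticCoeff := fun m =>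
  ![θ 0, θ 1, θ 2, θ 3, θ 4, θ 5, θ 6, θ 7, θ 8, θ 0 * t ^ 2, -(θ 5 * t + θ 1 * t ^ 2),
    -(2 * θ 0 * t), 0, 0, 0] (quarticEquiv.symm m)

/-- The coefficients of `binForm`. -/
def binCoeff (s : Equiv.Perm (Fin 3)) (θ : Fin 12 → ℂ) (t : ℂ) : QuarticCoeff :=
  pull (adaptedMatrix s θ) (binCoeffAdapted θ t)

lemma form_binCoeffAdapted (θ : Fin 12 → ℂ) (t : ℂ) : form (binCoeffAdapted θ t) =
    tac (fun i => C (θ i)) (X 0) (X 1) (X 2) + C (θ 0 * t ^ 2) * (X 0 ^ 2 * X 2 ^ 2) -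
      C (2 * θ 0 * t) * (X 0 ^ 3 * X 2) -
      C (θ 5 * t + θ 1 * t ^ 2) * (X 0 * X 1 * X 2 ^ 2) := by
  rw [form_eq]
  simp only [binCoeffAdapted, Equiv.symm_apply_apply, tac]
  simp
  ring

lemma eval_form_binCoeff (s : Equiv.Perm (Fin 3)) (θ : Fin 12 → ℂ) (t : ℂ) (Y : Fin 3 → ℂ) :
    eval Y (form (binCoeff s θ t)) = binForm θ t (Y ∘ s) := by
  rw [binCoeff, eval_form_pull, adaptedMatrix_mulVec, form_binCoeffAdapted]
  simp [binForm, tacForm, tac]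

lemma singularVec_binCoeffAdapted_zero (θ : Fin 12 → ℂ) (t : ℂ) :
    SingularVec (binCoeffAdapted θ t) ![0, 0, 1] := by
  refine ⟨by simp [form_binCoeffAdapted, tac], fun i => ?_⟩
  rw [grad, form_binCoeffAdapted]
  fin_cases i <;> simp [tac, pderiv_X, Derivation.leibniz, Derivation.leibniz_pow]

/-- The correction terms of `binForm` turn the part without y into θ 0 x ^ 2 (x - t z) ^ 2, and the
coefficient of y into x (x - t z) (θ 1 (x + t z) + θ 5 z). -/
lemma singularVec_binCoeffAdapted (θ : Fin 12 → ℂ) (t : ℂ) :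
    SingularVec (binCoeffAdapted θ t) ![t, 0, 1] := by
  refine ⟨by simp [form_binCoeffAdapted, tac]; ring, fun i => ?_⟩
  rw [grad, form_binCoeffAdapted]
  fin_cases i <;> simp [tac, pderiv_X, Derivation.leibniz, Derivation.leibniz_pow] <;> ring

lemma singularVec_binCoeff_zero (s : Equiv.Perm (Fin 3)) (θ : Fin 12 → ℂ) (t : ℂ) :
    SingularVec (binCoeff s θ t) (![θ 9, θ 10, 1] ∘ s.symm) := by
  apply SingularVec.pull
  have h : ![θ 9, θ 10, 1] ∘ s.symm = (adaptedInverse s θ).mulVec ![0, 0, 1] := by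
    rw [adaptedInverse_mulVec]
    simp
  rw [h, adaptedMatrix_mulVec_adaptedInverse]
  exact singularVec_binCoeffAdapted_zero θ t

lemma singularVec_binCoeff (s : Equiv.Perm (Fin 3)) (θ : Fin 12 → ℂ) (t : ℂ) :
    SingularVec (binCoeff s θ t) (![θ 9 + t, θ 10 + θ 11 * t, 1] ∘ s.symm) := by
  apply SingularVec.pull
  have h : ![θ 9 + t, θ 10 + θ 11 * t, 1] ∘ s.symm = (adaptedInverse s θ).mulVec ![t, 0, 1] := by
    rw [adaptedInverse_mulVec]
    simp [add_comm]
  rw [h, adaptedMatrix_mulVec_adaptedInverse]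
  exact singularVec_binCoeffAdapted θ t

lemma binCoeff_ne_zero (s : Equiv.Perm (Fin 3)) {θ : Fin 12 → ℂ}
    (hθ : ∃ i : Fin 9, θ (i.castLE (by norm_num)) ≠ 0) (t : ℂ) : binCoeff s θ t ≠ 0 := by
  intro h0
  have h1 : binCoeffAdapted θ t = 0 := by
    apply form_injective
    refine MvPolynomial.funext fun u => ?_
    rw [← adaptedMatrix_mulVec_adaptedInverse s θ u, ← eval_form_pull, ← binCoeff, h0]
    simp
  obtain ⟨i, hi⟩ := hθ
  apply hi
  have := congrFun h1 (quarticEquiv (i.castLE (by norm_num)))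
  rw [binCoeffAdapted, Equiv.symm_apply_apply] at this
  fin_cases i <;> exact this

/-- Every tacnodal quartic belongs to the family `tacForm`, up to a permutation of coordinates. -/
lemma exists_adapted_parameters {a : QuarticCoeff} {x v : Fin 3 → ℂ} (ha : a ≠ 0) (hx : x ≠ 0)
    (hs : SingularVec a x) (hv : v ∉ Submodule.span ℂ {x}) (ht : TacnodalVec a x v) :
    ∃ (s : Equiv.Perm (Fin 3)) (θ : Fin 12 → ℂ), (∃ i : Fin 9, θ (i.castLE (by norm_num)) ≠ 0) ∧
      a = binCoeff s θ 0 ∧ ∃ c : ℂ, c ≠ 0 ∧ x = c • (![θ 9, θ 10, 1] ∘ s.symm) := by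
  obtain ⟨k, hk⟩ := Function.ne_iff.1 hx
  simp only [Pi.zero_apply] at hk
  -- Changing v by a multiple of x makes its k-th coordinate zero. The permutation then sends k to
  -- the last place and a nonzero coordinate of v₁ to the first, so point and direction normalize to
  -- (θ 9, θ 10, 1) and (1, θ 11, 0).
  set v₁ : Fin 3 → ℂ := v - (v k / x k) • x with hv₁
  have hv₁k : v₁ k = 0 := by simp [hv₁, hk]
  have hv₁0 : v₁ ≠ 0 := fun h0 =>
    hv (Submodule.mem_span_singleton.2 ⟨v k / x k, (sub_eq_zero.1 h0).symm⟩)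
  obtain ⟨l, hl⟩ := Function.ne_iff.1 hv₁0
  simp only [Pi.zero_apply] at hl
  have hlk : l ≠ k := fun h => hl (h ▸ hv₁k)
  have hperm : ∀ k l : Fin 3, l ≠ k → ∃ s : Equiv.Perm (Fin 3), s 2 = k ∧ s 0 = l := by decide
  obtain ⟨s, rfl, rfl⟩ := hperm k l hlk
  set p : Fin 12 → ℂ := fun i => if i = 9 then x (s 0) / x (s 2) else
    if i = 10 then x (s 1) / x (s 2) else if i = 11 then v₁ (s 1) / v₁ (s 0) else 0 with hp
  have hp9 : p 9 = x (s 0) / x (s 2) := by simp [hp]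
  have hp10 : p 10 = x (s 1) / x (s 2) := by simp [hp]
  have hp11 : p 11 = v₁ (s 1) / v₁ (s 0) := by simp [hp]
  have hx' : (adaptedInverse s p).mulVec ![0, 0, 1] = (x (s 2))⁻¹ • x := by
    rw [adaptedInverse_mulVec, hp9, hp10]
    ext i
    obtain ⟨j, rfl⟩ := s.surjective i
    fin_cases j <;> simp [hk, div_eq_inv_mul]
  have hv' : (adaptedInverse s p).mulVec ![1, 0, 0] =
      (v₁ (s 0))⁻¹ • v + (-(v₁ (s 0))⁻¹ * (v (s 2) / x (s 2))) • x := by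
    have : ∀ r : ℂ, r • v + (-r * (v (s 2) / x (s 2))) • x = r • v₁ := fun r => by
      rw [hv₁]
      module
    rw [this, adaptedInverse_mulVec, hp11]
    ext i
    obtain ⟨j, rfl⟩ := s.surjective i
    fin_cases j <;> simp [hl, hv₁k, div_eq_inv_mul]
  set b := pull (adaptedInverse s p) a with hb
  have hbs : SingularVec b ![0, 0, 1] := by
    apply SingularVec.pull
    rw [hx', ← one_smul ℂ a]
    exact (singularVec_smul one_ne_zero (inv_ne_zero hk)).2 hs
  have hbt : TacnodalVec b ![0, 0, 1] ![1, 0, 0] := by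
    apply TacnodalVec.pull
    rw [hx', hv', ← one_smul ℂ a]
    exact (tacnodalVec_smul one_ne_zero (inv_ne_zero hk)).2 (ht.smul_add hs _ _)
  obtain ⟨b12, b13, b14⟩ := hbs.coeff
  obtain ⟨b9, b10, b11⟩ := hbt.coeff
  set θ : Fin 12 → ℂ := fun i => if h : i.1 < 9 then b (quarticEquiv ⟨i, by omega⟩) else p i with hθ
  have hinv : adaptedInverse s θ = adaptedInverse s p := by
    simp [adaptedInverse, hθ]
  have hbθ : b = binCoeffAdapted θ 0 := by
    ext m
    obtain ⟨i, rfl⟩ := quarticEquiv.surjective m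
    rw [binCoeffAdapted, Equiv.symm_apply_apply]
    fin_cases i <;> simp [hθ, b9, b10, b11, b12, b13, b14]
  have hab : a = binCoeff s θ 0 := by
    apply form_injective
    refine MvPolynomial.funext fun Y => ?_
    rw [binCoeff, eval_form_pull, ← hbθ, hb, eval_form_pull, ← hinv,
      adaptedInverse_mulVec_adaptedMatrix]
  refine ⟨s, θ, ?_, hab, x (s 2), hk, ?_⟩
  · by_contra! hc
    apply ha
    have hb0 : b = 0 := by
      ext m
      obtain ⟨i, rfl⟩ := quarticEquiv.surjective m
      by_cases hi : i.1 < 9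
      · simpa [hθ, hi] using hc ⟨i, hi⟩
      · have : i = 9 ∨ i = 10 ∨ i = 11 ∨ i = 12 ∨ i = 13 ∨ i = 14 := by
          revert hi i
          decide
        rcases this with rfl | rfl | rfl | rfl | rfl | rfl <;> assumption
    rw [hab, binCoeff, ← hbθ, hb0]
    apply form_injective
    rw [form_pull, map_zero, map_zero]
  · have h1 : ![θ 9, θ 10, 1] ∘ s.symm = (adaptedInverse s p).mulVec ![0, 0, 1] := by
      rw [← hinv, adaptedInverse_mulVec]
      simp
    rw [h1, hx', smul_smul, mul_inv_cancel₀ hk, one_smul]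

/-! ### Tacnodal quartics are limits of binodal quartics -/

open Topology Filter

lemma continuous_mk {V Z : Type*} [AddCommGroup V] [Module ℂ V] [TopologicalSpace V]
    [TopologicalSpace Z] {f : Z → V} (hf : Continuous f) (h : ∀ z, f z ≠ 0) :
    Continuous fun z => Projectivization.mk ℂ (f z) (h z) :=
  (continuous_coinduced_rng (f := (Projectivization.mk' ℂ : {v : V // v ≠ 0} → ℙ ℂ V))).comp
    (hf.subtype_mk h)

/-- Evaluation at all points is an injective linear map from a finite-dimensional space, hence a
closed embedding. -/
lemma continuous_quarticCoeff {Z : Type*} [TopologicalSpace Z] {f : Z → QuarticCoeff}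
    (hf : ∀ Y, Continuous fun z => eval Y (form (f z))) : Continuous f := by
  let T : QuarticCoeff →ₗ[ℂ] ((Fin 3 → ℂ) → ℂ) :=
    LinearMap.pi fun Y => (aeval Y).toLinearMap ∘ₗ form
  have hT : ∀ a Y, T a Y = eval Y (form a) := fun a Y => by simp [T, aeval_eq_eval]
  have hinj : LinearMap.ker T = ⊥ := by
    rw [LinearMap.ker_eq_bot]
    intro a b h
    apply form_injective
    refine MvPolynomial.funext fun Y => ?_
    rw [← hT, ← hT, h]
  rw [(LinearMap.isClosedEmbedding_of_injective hinj).continuous_iff, continuous_pi_iff]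
  simpa only [Function.comp_apply, hT] using hf

lemma contDiff_binForm (Y : Fin 3 → ℂ) :
    ContDiff ℂ 1 fun q : (Fin 12 → ℂ) × ℂ => binForm q.1 q.2 Y := by
  unfold binForm tacForm tac adaptedY adaptedX
  fun_prop

lemma hasDerivAt_tacForm (θ δ : Fin 12 → ℂ) (Y : Fin 3 → ℂ) :
    HasDerivAt (fun r : ℂ => tacForm (θ + r • δ) Y) (∑ i, paramGrad θ Y i * δ i) 0 := by
  let Θ : Fin 12 → Polynomial ℂ := fun i => Polynomial.C (θ i) + Polynomial.X * Polynomial.C (δ i)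
  let W : Fin 3 → Polynomial ℂ := fun l => Polynomial.C (Y l)
  have hΘ : ∀ r i, Polynomial.evalRingHom r (Θ i) = (θ + r • δ) i := fun r i => by
    simp [Θ]
    ring
  have hW : ∀ r l, Polynomial.evalRingHom r (W l) = Y l := fun r l => by simp [W]
  have h1 : ∀ r, Polynomial.eval r (tacForm Θ W) = tacForm (θ + r • δ) Y := fun r => by
    rw [← Polynomial.coe_evalRingHom, map_tacForm]
    simp only [hΘ, hW]
  have h2 : Polynomial.eval 0 (Polynomial.derivative (tacForm Θ W)) =
      ∑ i, paramGrad θ Y i * δ i := by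
    have h3 := derivation_tacForm (Polynomial.derivative' (R := ℂ)) Θ W
    have h4 : ∀ i, Polynomial.derivative' (Θ i) = Polynomial.C (δ i) := fun i => by
      change Polynomial.derivative (Θ i) = _
      simp [Θ]
    have h5 : ∀ l, Polynomial.derivative' (W l) = 0 := fun l => by
      change Polynomial.derivative (W l) = _
      simp [W]
    change Polynomial.derivative (tacForm Θ W) = _ at h3
    simp only [h4, h5, mul_zero, Finset.sum_const_zero, add_zero] at h3
    rw [h3, ← Polynomial.coe_evalRingHom, map_sum]
    simp only [map_mul, map_paramGrad, hΘ, hW]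
    simp
  have h := (tacForm Θ W).hasDerivAt 0
  rw [h2] at h
  simpa only [h1] using h

lemma mem_closure_binForm {w : Fin 11 × Fin 3 → ℂ} {θ : Fin 12 → ℂ}
    (hθ : ∃ i : Fin 9, θ (i.castLE (by norm_num)) ≠ 0)
    (hw : ∀ i, tacForm θ (fun l => w (i, l)) = 0) (hd : ¬ IsDegenerate w θ) :
    (θ, (0 : ℂ)) ∈ closure {q : (Fin 12 → ℂ) × ℂ |
      q.2 ≠ 0 ∧ ∀ i, binForm q.1 q.2 (fun l => w (i, l)) = 0} := by
  classical
  let G : (Fin 12 → ℂ) × ℂ → (Fin 11 → ℂ) × ℂ :=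
    fun q => (fun i => binForm q.1 q.2 (fun l => w (i, l)), q.2)
  have hG : ContDiff ℂ 1 G :=
    (contDiff_pi.2 fun i => contDiff_binForm _).prodMk contDiff_snd
  have hG' : HasStrictFDerivAt G (fderiv ℂ G (θ, 0)) (θ, 0) :=
    hG.contDiffAt.hasStrictFDerivAt one_ne_zero
  have hG0 : G (θ, 0) = (0, 0) := by
    ext i
    · simp [G, binForm_zero, hw]
    · rfl
  have hline : ∀ δ : Fin 12 → ℂ, fderiv ℂ G (θ, 0) (δ, 0) =
      (fun i => ∑ j, paramGrad θ (fun l => w (i, l)) j * δ j, 0) := by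
    intro δ
    have hl : HasDerivAt (fun r : ℂ => (θ, (0 : ℂ)) + r • (δ, (0 : ℂ))) (δ, 0) 0 := by
      simpa using ((hasDerivAt_id (0 : ℂ)).smul_const (δ, (0 : ℂ))).const_add (θ, (0 : ℂ))
    have h1 : HasDerivAt (fun r : ℂ => G ((θ, 0) + r • (δ, 0))) (fderiv ℂ G (θ, 0) (δ, 0)) 0 := by
      have hG₀ : HasFDerivAt G (fderiv ℂ G (θ, 0)) ((θ, (0 : ℂ)) + (0 : ℂ) • (δ, (0 : ℂ))) := by
        rw [zero_smul, add_zero]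
        exact hG'.hasFDerivAt
      exact hG₀.comp_hasDerivAt (0 : ℂ) hl
    have h2 : HasDerivAt (fun r : ℂ => G ((θ, 0) + r • (δ, 0)))
        (fun i => ∑ j, paramGrad θ (fun l => w (i, l)) j * δ j, 0) 0 := by
      have h3 : (fun r : ℂ => G ((θ, 0) + r • (δ, 0))) =
          fun r => (fun i => tacForm (θ + r • δ) (fun l => w (i, l)), 0) := by
        ext r i <;> simp [G, binForm_zero]
      rw [h3]
      exact (hasDerivAt_pi.2 fun i => hasDerivAt_tacForm θ δ _).prodMk (hasDerivAt_const _ _)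
    exact h1.unique h2
  have hsnd : (fderiv ℂ G (θ, 0) (0, 1)).2 = 1 := by
    have h1 : HasFDerivAt (fun q => (G q).2)
        ((ContinuousLinearMap.snd ℂ _ _).comp (fderiv ℂ G (θ, 0))) (θ, 0) :=
      (ContinuousLinearMap.snd ℂ (Fin 11 → ℂ) ℂ).hasFDerivAt.comp _ hG'.hasFDerivAt
    have h2 : HasFDerivAt (fun q => (G q).2) (ContinuousLinearMap.snd ℂ (Fin 12 → ℂ) ℂ) (θ, 0) :=
      hasFDerivAt_snd
    have := DFunLike.congr_fun (h1.unique h2) ((0 : Fin 12 → ℂ), (1 : ℂ))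
    simpa using this
  -- A functional killing the range restricts to a dependency μ among the rows of `paramGrad`. It
  -- cannot restrict to zero: the t-direction maps to something with second component 1, so f would
  -- vanish entirely.
  have hsurj : LinearMap.range (fderiv ℂ G (θ, 0)).toLinearMap = ⊤ := by
    by_contra hne
    obtain ⟨f, hf0, hf⟩ := Submodule.exists_le_ker_of_lt_top _ (lt_top_iff_ne_top.2 hne)
    have hfr : ∀ q, f (fderiv ℂ G (θ, 0) q) = 0 := fun q => hf ⟨q, rfl⟩
    have hfy : ∀ y : Fin 11 → ℂ, f (y, 0) = ∑ i, f (Pi.single i 1, 0) * y i := by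
      intro y
      have := LinearMap.pi_apply_eq_sum_univ (f ∘ₗ LinearMap.inl ℂ (Fin 11 → ℂ) ℂ) y
      simp only [LinearMap.comp_apply, LinearMap.inl_apply, smul_eq_mul] at this
      rw [this]
      refine Finset.sum_congr rfl fun i _ => ?_
      rw [mul_comm]
      congr 3
      ext j
      simp [Pi.single_apply, eq_comm]
    refine hd ⟨hθ, hw, fun i => f (Pi.single i 1, 0), ?_, fun j => ?_⟩
    · by_contra! hc
      apply hf0
      have h0 : ∀ y : Fin 11 → ℂ, f (y, 0) = 0 := fun y => by
        rw [hfy]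
        exact Finset.sum_eq_zero fun i _ => by rw [hc, zero_mul]
      have h1 : f (0, 1) = 0 := by
        have h2 := hfr (0, 1)
        have h3 : fderiv ℂ G (θ, 0) (0, 1) = ((fderiv ℂ G (θ, 0) (0, 1)).1, 0) + (0, 1) := by
          ext <;> simp [hsnd]
        rwa [h3, map_add, h0, zero_add] at h2
      ext y
      · simpa using h0 _
      · simpa using h1
    · have h1 := hfr (Pi.single j 1, 0)
      rw [hline, hfy] at h1
      simpa [Pi.single_apply] using h1
  -- A submersion is locally open, so every neighbourhood of (θ, 0) contains preimages of (0, t) for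
  -- small t ≠ 0.
  have hmap := hG'.map_nhds_eq_of_surj hsurj
  rw [hG0] at hmap
  rw [mem_closure_iff_nhds]
  intro U hU
  have hV : G '' U ∈ 𝓝 ((0 : Fin 11 → ℂ), (0 : ℂ)) := hmap ▸ image_mem_map hU
  have hc : Tendsto (fun t : ℂ => ((0 : Fin 11 → ℂ), t)) (𝓝[≠] 0) (𝓝 (0, 0)) :=
    (Continuous.tendsto (by fun_prop) (0 : ℂ)).mono_left nhdsWithin_le_nhds
  obtain ⟨t, ⟨q, hqU, hq⟩, ht⟩ := ((hc.eventually hV).and self_mem_nhdsWithin).exists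
  have hq2 : q.2 = t := congrArg Prod.snd hq
  refine ⟨q, hqU, ?_, fun i => congrFun (congrArg Prod.fst hq) i⟩
  rw [hq2]
  exact ht

lemma mk_mem_quarticsThrough {n : ℕ} {w : Fin n × Fin 3 → ℂ} (hw : ∀ i, (fun l => w (i, l)) ≠ 0)
    {a : QuarticCoeff} (ha : a ≠ 0) (h : ∀ i, eval (fun l => w (i, l)) (form a) = 0) :
    Projectivization.mk ℂ a ha ∈
      quarticsThrough fun i => Projectivization.mk ℂ (fun l => w (i, l)) (hw i) := by
  change (Projectivization.mk ℂ a ha).submodule ≤ _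
  rw [Projectivization.submodule_mk, Submodule.span_singleton_le_iff_mem]
  exact fun i => (eval_rep_mk_eq_zero_iff a (hw i)).2 (h i)

lemma eval_rep_of_mem_quarticsThrough {n : ℕ} {w : Fin n × Fin 3 → ℂ}
    (hw : ∀ i, (fun l => w (i, l)) ≠ 0) {a : QuarticSpace}
    (ha : a ∈ quarticsThrough fun i => Projectivization.mk ℂ (fun l => w (i, l)) (hw i))
    (i : Fin n) : eval (fun l => w (i, l)) (form a.rep) = 0 := by
  have h : a.rep ∈ a.submodule := by
    rw [Projectivization.submodule_eq]
    exact Submodule.mem_span_singleton_self _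
  exact (eval_rep_mk_eq_zero_iff _ (hw i)).1 (ha h i)

lemma continuous_binCoeff (s : Equiv.Perm (Fin 3)) :
    Continuous fun q : (Fin 12 → ℂ) × ℂ => binCoeff s q.1 q.2 :=
  continuous_quarticCoeff fun Y => by
    simpa only [eval_form_binCoeff] using (contDiff_binForm (Y ∘ s)).continuous

theorem mem_closure_binodalLocus {w : Fin 11 × Fin 3 → ℂ} (hw : ∀ i, (fun l => w (i, l)) ≠ 0)
    (hd : ∀ (s : Equiv.Perm (Fin 3)) θ, ¬ IsDegenerate (fun q => w (q.1, s q.2)) θ)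
    (z : nodalPairs (fun i => Projectivization.mk ℂ (fun l => w (i, l)) (hw i)) × P2)
    (hz : z.1.1.2 = z.2) (ht : z.1 ∈ tacnodalPairs _) : z ∈ closure (binodalLocus _) := by
  obtain ⟨v, hv, htv⟩ := ht
  rw [Projectivization.submodule_eq] at hv
  obtain ⟨s, θ, hθ, ha, c, hc, hx⟩ := exists_adapted_parameters
    (Projectivization.rep_nonzero _) (Projectivization.rep_nonzero _) z.1.2 hv htv
  have hθw : ∀ i, tacForm θ (fun l => w (i, s l)) = 0 := fun i => by
    have := eval_rep_of_mem_quarticsThrough hw z.1.1.1.2 i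
    rwa [ha, eval_form_binCoeff, binForm_zero] at this
  -- The parameter space of deformations through the given points; Ψ maps it continuously to pairs
  -- of nodes, and those with t ≠ 0 land in the binodal locus.
  let A := {q : (Fin 12 → ℂ) × ℂ // (∃ i : Fin 9, q.1 (i.castLE (by norm_num)) ≠ 0) ∧
    ∀ i, binForm q.1 q.2 (fun l => w (i, s l)) = 0}
  have h1 : ∀ (q : A) r, ![q.1.1 9 + r, q.1.1 10 + q.1.1 11 * r, 1] ∘ s.symm ≠ 0 := fun q r h => by
    simpa using congrFun h (s 2)
  have h2 : ∀ q : A, binCoeff s q.1.1 q.1.2 ≠ 0 := fun q => binCoeff_ne_zero s q.2.1 _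
  have h3 : ∀ q : A, SingularVec (binCoeff s q.1.1 q.1.2)
      (![q.1.1 9 + 0, q.1.1 10 + q.1.1 11 * 0, 1] ∘ s.symm) := fun q => by
    rw [add_zero, mul_zero, add_zero]
    exact singularVec_binCoeff_zero s q.1.1 q.1.2
  let Ψ : A → nodalPairs (fun i => Projectivization.mk ℂ (fun l => w (i, l)) (hw i)) × P2 :=
    fun q => (⟨(⟨Projectivization.mk ℂ _ (h2 q), mk_mem_quarticsThrough hw (h2 q) fun i => by
      rw [eval_form_binCoeff]; exact q.2.2 i⟩, Projectivization.mk ℂ _ (h1 q 0)),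
      (isSingularAt_mk (h2 q) (h1 q 0)).2 (h3 q)⟩, Projectivization.mk ℂ _ (h1 q q.1.2))
  have hpt : ∀ r : A → ℂ, Continuous r → Continuous fun q : A =>
      ![q.1.1 9 + r q, q.1.1 10 + q.1.1 11 * r q, 1] ∘ s.symm := fun r hr => by
    refine continuous_pi fun i => ?_
    obtain ⟨j, rfl⟩ := s.surjective i
    fin_cases j <;> simp <;> fun_prop
  have hΨ : Continuous Ψ := by
    refine Continuous.prodMk (Continuous.subtype_mk (Continuous.prodMk
      (Continuous.subtype_mk (continuous_mk ?_ _) _) (continuous_mk (hpt _ ?_) _)) _)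
      (continuous_mk (hpt _ ?_) _)
    · exact (continuous_binCoeff s).comp continuous_subtype_val
    · fun_prop
    · fun_prop
  let q₀ : A := ⟨(θ, 0), hθ, fun i => by rw [binForm_zero, hθw]⟩
  have hq₀ : q₀ ∈ closure {q : A | q.1.2 ≠ 0} := by
    have h := mem_closure_binForm (w := fun q => w (q.1, s q.2)) hθ hθw (hd s θ)
    rw [mem_closure_iff_frequently] at h
    have ho : ∀ᶠ q : (Fin 12 → ℂ) × ℂ in nhds (θ, 0),
        ∃ i : Fin 9, q.1 (i.castLE (by norm_num)) ≠ 0 := by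
      obtain ⟨i, hi⟩ := hθ
      have hc : Continuous fun q : (Fin 12 → ℂ) × ℂ => q.1 (i.castLE (by norm_num)) := by fun_prop
      exact (hc.continuousAt.eventually_ne hi).mono fun q hq => ⟨i, hq⟩
    rw [closure_subtype, mem_closure_iff_frequently]
    refine (h.and_eventually ho).mono ?_
    rintro q ⟨⟨hq1, hq2⟩, hq3⟩
    exact ⟨⟨q, hq3, hq2⟩, hq1, rfl⟩
  have hΨq₀ : Ψ q₀ = z := by
    have e1 : Projectivization.mk ℂ _ (h2 q₀) = z.1.1.1.1 := by
      conv_rhs => rw [← Projectivization.mk_rep z.1.1.1.1]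
      congr 1
      exact ha.symm
    have e2 : Projectivization.mk ℂ _ (h1 q₀ 0) = z.1.1.2 := by
      conv_rhs => rw [← Projectivization.mk_rep z.1.1.2]
      rw [Projectivization.mk_eq_mk_iff']
      refine ⟨c⁻¹, ?_⟩
      rw [hx, smul_smul, inv_mul_cancel₀ hc, one_smul, add_zero, mul_zero, add_zero]
    refine Prod.ext (Subtype.ext (Prod.ext (Subtype.ext e1) e2)) ?_
    rw [← hz]
    exact e2
  rw [← hΨq₀]
  refine map_mem_closure hΨ hq₀ fun q hq => ⟨fun heq => hq ?_, ?_⟩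
  -- If the two nodes coincide, the coordinate s 2, equal to 1 for both, forces r = 1, and the
  -- coordinate s 0 then gives t = 0.
  · obtain ⟨r, hr⟩ := (Projectivization.mk_eq_mk_iff' ℂ _ _ (h1 q 0) (h1 q q.1.2)).1 heq
    have r2 := congrFun hr (s 2)
    have r0 := congrFun hr (s 0)
    simp at r2 r0
    rw [r2] at r0
    simpa using r0
  · exact (isSingularAt_mk (h2 q) (h1 q q.1.2)).2 (singularVec_binCoeff s q.1.1 q.1.2)

/-! ### Limits of binodal quartics are tacnodal -/

lemma pderiv_ofNat {σ R : Type*} [CommRing R] (i : σ) (n : ℕ) [n.AtLeastTwo] :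
    pderiv i (ofNat(n) : MvPolynomial σ R) = 0 :=
  (pderiv i).map_natCast n

set_option maxHeartbeats 1000000 in
lemma eval_form_add_smul (a : QuarticCoeff) (x v : Fin 3 → ℂ) (t : ℂ) :
    eval (x + t • v) (form a) = eval x (form a) + t * ∑ i, v i * grad a x i +
      t ^ 2 / 2 * ∑ i, v i * ∑ j, hess a x i j * v j + t ^ 3 * ∑ i, x i * grad a v i +
      t ^ 4 * eval v (form a) := by
  simp only [grad, hess, form_eq, Fin.sum_univ_three]
  simp [pderiv_X, Derivation.leibniz, Derivation.leibniz_pow, pderiv_ofNat]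
  ring

set_option maxHeartbeats 1000000 in
lemma grad_add_smul (a : QuarticCoeff) (x v : Fin 3 → ℂ) (t : ℂ) (i : Fin 3) :
    grad a (x + t • v) i = grad a x i + t * ∑ j, hess a x i j * v j +
      t ^ 2 * ∑ j, hess a v i j * x j + t ^ 3 * grad a v i := by
  simp only [grad, hess, form_eq, Fin.sum_univ_three]
  fin_cases i <;> simp [pderiv_X, Derivation.leibniz, Derivation.leibniz_pow, pderiv_ofNat] <;> ring

-- Both sides are six times the t ^ 3 coefficient of the form at x + t v: in degree 4, the terms
-- cubic in v are linear in x.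
set_option maxHeartbeats 1000000 in
lemma sum_third (a : QuarticCoeff) (x v : Fin 3 → ℂ) :
    ∑ i, ∑ j, ∑ k, third a x i j k * v i * v j * v k = 6 * ∑ i, x i * grad a v i := by
  simp only [grad, third, form_eq, Fin.sum_univ_three]
  simp [pderiv_X, Derivation.leibniz, Derivation.leibniz_pow, pderiv_ofNat]
  ring

lemma SingularVec.hess_mulVec {a : QuarticCoeff} {x v : Fin 3 → ℂ} {t : ℂ} (ht : t ≠ 0)
    (h₁ : SingularVec a x) (h₂ : SingularVec a (x + t • v)) (i : Fin 3) :
    ∑ j, hess a x i j * v j = -t * ∑ j, hess a v i j * x j - t ^ 2 * grad a v i := by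
  have h := grad_add_smul a x v t i
  rw [h₁.2, h₂.2] at h
  apply mul_left_cancel₀ ht
  linear_combination -h

/-- Substitute the Hessian term from `hess_mulVec` into the Taylor expansion and reduce with Euler's
identities at v; after dividing by t ^ 3 only a multiple of t s_a(v) is left. -/
lemma SingularVec.sum_third {a : QuarticCoeff} {x v : Fin 3 → ℂ} {t : ℂ} (ht : t ≠ 0)
    (h₁ : SingularVec a x) (h₂ : SingularVec a (x + t • v)) :
    ∑ i, ∑ j, ∑ k, third a x i j k * v i * v j * v k = -12 * t * eval v (form a) := by
  rw [PlaneQuartic.sum_third]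
  have hf := eval_form_add_smul a x v t
  simp only [h₁.1, h₂.1, h₁.2, mul_zero, Finset.sum_const_zero,
    h₁.hess_mulVec ht h₂] at hf
  have he : ∑ i, v i * grad a v i = 4 * eval v (form a) := by
    exact_mod_cast euler (form_isHomogeneous a) v
  have hh := sum_mul_hess a v
  have hh0 := hh 0
  have hh1 := hh 1
  have hh2 := hh 2
  have hs := hess_symm a v
  simp only [Fin.sum_univ_three, hs 1 0, hs 2 0, hs 2 1] at hf he hh0 hh1 hh2 ⊢
  apply mul_left_cancel₀ (pow_ne_zero 3 ht)
  linear_combination 12 * hf - 6 * t ^ 4 * he -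
    6 * t ^ 3 * (x 0 * hh0 + x 1 * hh1 + x 2 * hh2)

lemma continuous_eval_form :
    Continuous fun q : QuarticCoeff × (Fin 3 → ℂ) => eval q.2 (form q.1) := by
  simp only [eval_form]
  fun_prop

lemma continuous_grad (i : Fin 3) :
    Continuous fun q : QuarticCoeff × (Fin 3 → ℂ) => grad q.1 q.2 i := by
  have h (q : QuarticCoeff × (Fin 3 → ℂ)) : grad q.1 q.2 i = ∑ j, q.1 (quarticEquiv j) *
      eval q.2 (pderiv i (∏ l, X l ^ quarticExponents j l)) := by
    simp [grad, form_eq_sum]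
  simp only [h]
  exact continuous_finsetSum _ fun j _ =>
    ((continuous_apply _).comp continuous_fst).mul ((continuous_eval _).comp continuous_snd)

lemma continuous_hess (i j : Fin 3) :
    Continuous fun q : QuarticCoeff × (Fin 3 → ℂ) => hess q.1 q.2 i j := by
  have h (q : QuarticCoeff × (Fin 3 → ℂ)) : hess q.1 q.2 i j = ∑ k, q.1 (quarticEquiv k) *
      eval q.2 (pderiv i (pderiv j (∏ l, X l ^ quarticExponents k l))) := by
    simp [hess, form_eq_sum]
  simp only [h]
  exact continuous_finsetSum _ fun j _ =>
    ((continuous_apply _).comp continuous_fst).mul ((continuous_eval _).comp continuous_snd)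

section Limits

variable {α : Type*} {l : Filter α} {f : α → QuarticCoeff} {g : α → Fin 3 → ℂ}
  {a : QuarticCoeff} {x : Fin 3 → ℂ}

lemma tendsto_eval_form (hf : Tendsto f l (𝓝 a)) (hg : Tendsto g l (𝓝 x)) :
    Tendsto (fun n => eval (g n) (form (f n))) l (𝓝 (eval x (form a))) := by
  have h := continuous_eval_form.tendsto (a, x)
  have h' := h.comp (hf.prodMk_nhds hg)
  exact h'

lemma tendsto_grad (hf : Tendsto f l (𝓝 a)) (hg : Tendsto g l (𝓝 x)) (i : Fin 3) :
    Tendsto (fun n => grad (f n) (g n) i) l (𝓝 (grad a x i)) := by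
  have h := (continuous_grad i).tendsto (a, x)
  have h' := h.comp (hf.prodMk_nhds hg)
  exact h'

lemma tendsto_hess (hf : Tendsto f l (𝓝 a)) (hg : Tendsto g l (𝓝 x)) (i j : Fin 3) :
    Tendsto (fun n => hess (f n) (g n) i j) l (𝓝 (hess a x i j)) := by
  have h := (continuous_hess i j).tendsto (a, x)
  have h' := h.comp (hf.prodMk_nhds hg)
  exact h'

/-- If quartics are singular at points `x` and `x + t • v` with `t` tending to zero, then the limit
is tacnodal in the limiting direction. -/
lemma tacnodalVec_of_tendsto [l.NeBot] {h : α → Fin 3 → ℂ} {t : α → ℂ} {v : Fin 3 → ℂ}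
    (hf : Tendsto f l (𝓝 a)) (hg : Tendsto g l (𝓝 x)) (hh : Tendsto h l (𝓝 v))
    (ht : Tendsto t l (𝓝 0)) (ht0 : ∀ n, t n ≠ 0) (hs : ∀ n, SingularVec (f n) (g n))
    (hs' : ∀ᶠ n in l, SingularVec (f n) (g n + t n • h n)) : TacnodalVec a x v := by
  have hvi : ∀ i, Tendsto (fun n => h n i) l (𝓝 (v i)) := tendsto_pi_nhds.1 hh
  have hxi : ∀ i, Tendsto (fun n => g n i) l (𝓝 (x i)) := tendsto_pi_nhds.1 hg
  refine ⟨fun i => ?_, ?_⟩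
  · have h1 : Tendsto (fun n => ∑ j, hess (f n) (g n) i j * h n j) l
        (𝓝 (∑ j, hess a x i j * v j)) :=
      tendsto_finsetSum _ fun j _ => (tendsto_hess hf hg i j).mul (hvi j)
    have h2 : Tendsto (fun n => -t n * ∑ j, hess (f n) (h n) i j * g n j -
        t n ^ 2 * grad (f n) (h n) i) l
        (𝓝 (-0 * ∑ j, hess a v i j * x j - 0 ^ 2 * grad a v i)) :=
      (ht.neg.mul (tendsto_finsetSum _ fun j _ => (tendsto_hess hf hh i j).mul (hxi j))).sub
        ((ht.pow 2).mul (tendsto_grad hf hh i))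
    have h3 := tendsto_nhds_unique (h1.congr' (hs'.mono fun n hn =>
      (hs n).hess_mulVec (ht0 n) hn i)) h2
    simpa using h3
  · rw [sum_third]
    have h1 : Tendsto (fun n => 6 * ∑ i, g n i * grad (f n) (h n) i) l
        (𝓝 (6 * ∑ i, x i * grad a v i)) :=
      tendsto_const_nhds.mul (tendsto_finsetSum _ fun i _ => (hxi i).mul (tendsto_grad hf hh i))
    have h2 : Tendsto (fun n => -12 * t n * eval (h n) (form (f n))) l
        (𝓝 (-12 * 0 * eval v (form a))) :=
      (tendsto_const_nhds.mul ht).mul (tendsto_eval_form hf hh)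
    have h3 := tendsto_nhds_unique (h1.congr' (hs'.mono fun n hn => by
      rw [← sum_third]
      exact (hs n).sum_third (ht0 n) hn)) h2
    simpa using h3

end Limits

lemma isClosed_singularVec :
    IsClosed {q : QuarticCoeff × (Fin 3 → ℂ) | SingularVec q.1 q.2} := by
  have : {q : QuarticCoeff × (Fin 3 → ℂ) | SingularVec q.1 q.2} =
      {q | eval q.2 (form q.1) = 0} ∩ ⋂ i, {q | grad q.1 q.2 i = 0} := by
    ext q
    simp [SingularVec]
  rw [this]
  exact (isClosed_eq continuous_eval_form continuous_const).inter
    (isClosed_iInter fun i => isClosed_eq (continuous_grad i) continuous_const)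

/-- Vectors over the pairs of distinct singular points of a quartic. -/
def binodalVectors : Set (QuarticCoeff × (Fin 3 → ℂ) × (Fin 3 → ℂ)) :=
  {q | SingularVec q.1 q.2.1 ∧ SingularVec q.1 q.2.2 ∧ ∀ c : ℂ, c • q.2.2 ≠ q.2.1}

theorem exists_tacnodalVec_of_mem_closure {a : QuarticCoeff} {x : Fin 3 → ℂ} (hx : x ≠ 0)
    (h : (a, x, x) ∈ closure binodalVectors) :
    ∃ v : Fin 3 → ℂ, v ∉ Submodule.span ℂ {x} ∧ TacnodalVec a x v := by
  obtain ⟨q, hq, hlim⟩ := mem_closure_iff_seq_limit.1 h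
  obtain ⟨k, hk⟩ := Function.ne_iff.1 hx
  simp only [Pi.zero_apply] at hk
  have ha : Tendsto (fun n => (q n).1) atTop (𝓝 a) := (continuous_fst.tendsto _).comp hlim
  have hx₁ : Tendsto (fun n => (q n).2.1) atTop (𝓝 x) :=
    ((continuous_fst.comp continuous_snd).tendsto (a, x, x)).comp hlim
  have hy₁ : Tendsto (fun n => (q n).2.2) atTop (𝓝 x) :=
    ((continuous_snd.comp continuous_snd).tendsto (a, x, x)).comp hlim
  have hxk : Tendsto (fun n => (q n).2.1 k) atTop (𝓝 (x k)) := (tendsto_pi_nhds.1 hx₁) k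
  have hyk : Tendsto (fun n => (q n).2.2 k) atTop (𝓝 (x k)) := (tendsto_pi_nhds.1 hy₁) k
  -- Rescaling the second point to have the same k-th coordinate as the first makes the k-th
  -- coordinate of d vanish eventually. The limiting unit direction then has k-th coordinate zero,
  -- so it is not a multiple of x.
  set r : ℕ → ℂ := fun n => (q n).2.1 k / (q n).2.2 k with hr
  set d : ℕ → Fin 3 → ℂ := fun n => r n • (q n).2.2 - (q n).2.1 with hd
  have hrlim : Tendsto r atTop (𝓝 1) := by
    have := hxk.div hyk hk
    rwa [div_self hk] at this
  have hdlim : Tendsto d atTop (𝓝 0) := by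
    have := (hrlim.smul hy₁).sub hx₁
    rwa [one_smul, sub_self] at this
  have hd0 : ∀ n, d n ≠ 0 := fun n h0 => (hq n).2.2 (r n) (sub_eq_zero.1 h0)
  set t : ℕ → ℂ := fun n => (‖d n‖ : ℂ) with ht
  have ht0 : ∀ n, t n ≠ 0 := fun n => by simpa [ht] using hd0 n
  have htlim : Tendsto t atTop (𝓝 0) := by
    have := (Complex.continuous_ofReal.tendsto 0).comp (tendsto_zero_iff_norm_tendsto_zero.1 hdlim)
    simpa [ht, Function.comp_def] using this
  set u : ℕ → Fin 3 → ℂ := fun n => (t n)⁻¹ • d n with hu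
  have hu1 : ∀ n, u n ∈ Metric.sphere (0 : Fin 3 → ℂ) 1 := fun n => by
    simp [hu, ht, norm_smul, hd0 n]
  obtain ⟨v, hv, φ, hφ, hvlim⟩ := (isCompact_sphere (0 : Fin 3 → ℂ) 1).tendsto_subseq hu1
  have hφ' := hφ.tendsto_atTop
  have hev : ∀ᶠ n in atTop, (q (φ n)).2.1 k ≠ 0 ∧ (q (φ n)).2.2 k ≠ 0 :=
    hφ'.eventually ((hxk.eventually_ne hk).and (hyk.eventually_ne hk))
  have hsing : ∀ᶠ n in atTop,
      SingularVec (q (φ n)).1 ((q (φ n)).2.1 + t (φ n) • u (φ n)) := by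
    filter_upwards [hev] with n hn
    have : (q (φ n)).2.1 + t (φ n) • u (φ n) = r (φ n) • (q (φ n)).2.2 := by
      simp only [hu, smul_smul, mul_inv_cancel₀ (ht0 _), one_smul, hd]
      abel
    rw [this, ← one_smul ℂ (q (φ n)).1]
    exact (singularVec_smul one_ne_zero (div_ne_zero hn.1 hn.2)).2 (hq _).2.1
  have ha' := ha.comp hφ'
  have hx' := hx₁.comp hφ'
  have ht' := htlim.comp hφ'
  refine ⟨v, fun hmem => ?_, tacnodalVec_of_tendsto ha' hx' hvlim ht' (fun n => ht0 _)
    (fun n => (hq _).1) hsing⟩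
  · obtain ⟨c, rfl⟩ := Submodule.mem_span_singleton.1 hmem
    have hk0 : Tendsto (fun n => u (φ n) k) atTop (𝓝 0) := by
      refine tendsto_const_nhds.congr' ?_
      filter_upwards [hev] with n hn
      simp [hu, hd, hr, div_mul_cancel₀ _ hn.2]
    have hck := tendsto_nhds_unique (tendsto_pi_nhds.1 hvlim k) hk0
    have hc : c = 0 := by simpa [hk] using hck
    simp [hc] at hv

/-! ### Lifting closures from projective spaces to vectors -/

lemma isOpenMap_mk' {V : Type*} [AddCommGroup V] [Module ℂ V] [TopologicalSpace V]
    [ContinuousConstSMul ℂ V] :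
    IsOpenMap (Projectivization.mk' ℂ : {v : V // v ≠ 0} → ℙ ℂ V) := by
  intro U hU
  rw [isOpen_coinduced]
  -- The saturation of U is a union of preimages of U under scalings.
  have : (Projectivization.mk' ℂ : {v : V // v ≠ 0} → ℙ ℂ V) ⁻¹' (Projectivization.mk' ℂ '' U) =
      ⋃ c : ℂˣ, (fun v : {v : V // v ≠ 0} =>
        (⟨c • v.1, (smul_ne_zero_iff_ne c).2 v.2⟩ : {v : V // v ≠ 0})) ⁻¹' U := by
    ext v
    simp only [Set.mem_preimage, Set.mem_image, Set.mem_iUnion]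
    constructor
    · rintro ⟨u, hu, huv⟩
      obtain ⟨c, hc⟩ := (Projectivization.mk_eq_mk_iff ℂ u.1 v.1 u.2 v.2).1 huv
      refine ⟨c, ?_⟩
      convert hu
    · rintro ⟨c, hc⟩
      exact ⟨_, hc, (Projectivization.mk_eq_mk_iff ℂ _ _ _ _).2 ⟨c, rfl⟩⟩
  rw [this]
  refine isOpen_iUnion fun c => hU.preimage (Continuous.subtype_mk ?_ _)
  exact (continuous_const_smul (c : ℂ)).comp continuous_subtype_val

/-- The quotient maps are open, so preimages of closures lie in closures of preimages; the chosen
representatives are therefore limits of vectors over binodal quartics. -/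
lemma mem_closure_binodalVectors {n : ℕ} {p : Fin n → P2} {z : nodalPairs p × P2}
    (hz : z ∈ closure (binodalLocus p)) :
    (z.1.1.1.1.rep, z.1.1.2.rep, z.2.rep) ∈ closure binodalVectors := by
  let ι : nodalPairs p × P2 → QuarticSpace × P2 × P2 := fun z => (z.1.1.1.1, z.1.1.2, z.2)
  have hι : Continuous ι := by fun_prop
  let B : Set (QuarticSpace × P2 × P2) :=
    {q | IsSingularAt q.1 q.2.1 ∧ IsSingularAt q.1 q.2.2 ∧ q.2.1 ≠ q.2.2}
  have h1 : ι z ∈ closure B := map_mem_closure hι hz fun y hy => ⟨y.1.2, hy.2, hy.1⟩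
  let π : {a : QuarticCoeff // a ≠ 0} × {x : Fin 3 → ℂ // x ≠ 0} × {x : Fin 3 → ℂ // x ≠ 0} →
      QuarticSpace × P2 × P2 :=
    Prod.map (Projectivization.mk' ℂ) (Prod.map (Projectivization.mk' ℂ) (Projectivization.mk' ℂ))
  have hπ : IsOpenMap π := isOpenMap_mk'.prodMap (isOpenMap_mk'.prodMap isOpenMap_mk')
  let y : {a : QuarticCoeff // a ≠ 0} × {x : Fin 3 → ℂ // x ≠ 0} × {x : Fin 3 → ℂ // x ≠ 0} :=
    (⟨_, z.1.1.1.1.rep_nonzero⟩, ⟨_, z.1.1.2.rep_nonzero⟩, ⟨_, z.2.rep_nonzero⟩)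
  have hy : π y = ι z := by
    simp [π, y, ι, Projectivization.mk'_eq_mk]
  have h2 : y ∈ closure (π ⁻¹' B) :=
    hπ.preimage_closure_subset_closure_preimage (by rw [Set.mem_preimage, hy]; exact h1)
  have hval : Continuous fun q : {a : QuarticCoeff // a ≠ 0} × {x : Fin 3 → ℂ // x ≠ 0} ×
      {x : Fin 3 → ℂ // x ≠ 0} => (q.1.1, q.2.1.1, q.2.2.1) := by fun_prop
  have h3 := map_mem_closure (t := binodalVectors) hval h2
  refine h3 ?_
  rintro ⟨⟨a, ha⟩, ⟨x, hx⟩, ⟨x', hx'⟩⟩ ⟨hs1, hs2, hne⟩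
  refine ⟨(isSingularAt_mk ha hx).1 hs1, (isSingularAt_mk ha hx').1 hs2, fun c hc => hne ?_⟩
  exact (Projectivization.mk_eq_mk_iff' ℂ x x' hx hx').2 ⟨c, hc⟩

theorem closure_binodalLocus_diff_subset {n : ℕ} {p : Fin n → P2} {z : nodalPairs p × P2}
    (hz : z ∈ closure (binodalLocus p)) (hz' : z ∉ binodalLocus p) :
    z.1.1.2 = z.2 ∧ z.1 ∈ tacnodalPairs p := by
  have h := mem_closure_binodalVectors hz
  have hs : SingularVec z.1.1.1.1.rep z.2.rep := by
    have hc : Continuous fun q : QuarticCoeff × (Fin 3 → ℂ) × (Fin 3 → ℂ) => (q.1, q.2.2) := by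
      fun_prop
    have h2 := map_mem_closure
      (t := {q : QuarticCoeff × (Fin 3 → ℂ) | SingularVec q.1 q.2}) hc h fun q hq => hq.2.1
    rw [isClosed_singularVec.closure_eq] at h2
    exact h2
  have heq : z.1.1.2 = z.2 := by
    by_contra hne
    exact hz' ⟨hne, hs⟩
  refine ⟨heq, ?_⟩
  rw [← heq] at h
  obtain ⟨v, hv, ht⟩ := exists_tacnodalVec_of_mem_closure (Projectivization.rep_nonzero _) h
  refine ⟨v, ?_, ht⟩
  rwa [Projectivization.submodule_eq]

end PlaneQuartic

end

/-! ### The polynomial defining general position -/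

theorem mainTheorem12 :
    PlaneQuartic.ForGeneralPoints 11 fun p : Fin 11 → PlaneQuartic.P2 =>
      Module.finrank ℂ (PlaneQuartic.formsThrough p) = 4 ∧
      closure (PlaneQuartic.binodalLocus p) \ PlaneQuartic.binodalLocus p =
        {z : PlaneQuartic.nodalPairs p × PlaneQuartic.P2 |
          z.1.1.2 = z.2 ∧ z.1 ∈ PlaneQuartic.tacnodalPairs p} := by
  classical
  obtain ⟨F, hF, hFd⟩ := PlaneQuartic.exists_polynomial_of_isDegenerate
  let σ : Equiv.Perm (Fin 3) → Fin 11 × Fin 3 → Fin 11 × Fin 3 := fun s q => (q.1, s q.2)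
  have hσ : ∀ s, Function.Injective (σ s) := fun s q q' h => by
    obtain ⟨h1, h2⟩ := Prod.mk.inj h
    exact Prod.ext h1 (s.injective h2)
  -- The determinant secures the dimension of 𝒟. The factors indexed by s exclude degeneracy in each
  -- of the permuted charts needed to normalize a tacnode.
  refine PlaneQuartic.forGeneralPoints_of_vectors
    (PlaneQuartic.monomialDet * ∏ s, MvPolynomial.rename (σ s) F)
    (mul_ne_zero PlaneQuartic.monomialDet_ne_zero (Finset.prod_ne_zero_iff.2 fun s _ => ?_))
    fun w hw h => ?_
  · rw [Ne, ← map_zero (MvPolynomial.rename (σ s))]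
    exact fun h => hF (MvPolynomial.rename_injective _ (hσ s) h)
  · rw [map_mul, map_prod, mul_ne_zero_iff, Finset.prod_ne_zero_iff] at h
    have hd : ∀ (s : Equiv.Perm (Fin 3)) θ,
        ¬ PlaneQuartic.IsDegenerate (fun q => w (q.1, s q.2)) θ := fun s θ hdeg => by
      refine h.2 s (Finset.mem_univ s) ?_
      rw [MvPolynomial.eval_rename]
      exact hFd _ θ hdeg
    refine ⟨PlaneQuartic.finrank_formsThrough_mk hw h.1, Set.ext fun z => ⟨fun hz => ?_, fun hz => ?_⟩⟩
    · exact PlaneQuartic.closure_binodalLocus_diff_subset hz.1 hz.2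
    · exact ⟨PlaneQuartic.mem_closure_binodalLocus hw hd z hz.1 hz.2, fun hb => hb.1 hz.1⟩
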